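/- **Setting.** Let $M$ be a compact (connected) Riemannian manifold without boundary, with Riemannian distance $\|x-y\|$; let $0<\nu<1$, $0<\alpha\le 1$ and $2\le k<d$. For $m\ge 2$ let $\Sigma_m=\{1,\dots,m\}^{\mathbb Z}$ with the shift $(\tau\xi)_i=\xi_{i+1}$ and the metric $d_{\Sigma}(\xi,\zeta)=\nu^{\ell}$, $\ell=\min\{i\ge 0:\xi_i\ne\zeta_i\text{ or }\xi_{-i}\neq\zeta_{-i}\}$ ($d_\Sigma(\xi,\xi)=0$); $\Sigma_k\subset\Sigma_d$. Put $W^s_{loc}(\xi;\tau)=\{\zeta:\zeta_i=\xi_i,\ i\ge0\}$ and $W^u_{loc}(\xi;\tau)=\{\zeta:\zeta_i=\xi_i,\ i\le0\}$. A *symbolic skew-product* is a map $\Phi=\tau\times\phi_\xi$ of $\Sigma_m\times M$, $\Phi(\xi,x)=(\tau\xi,\phi_\xi(x))$, with $\phi_\xi$ homeomorphisms of $M$ depending continuously on $\xi$; it is *one-step*, $\Phi=\tau\times(\phi_1,\dots,\phi_m)$, if $\phi_\xi=\phi_{\xi_0}$. For an open $D\subset M$ and $0<\lambda<\beta$, $\mathcal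 S^{r,\alpha}_{m,\lambda,\beta}(D)$ ($r=0,1$) is the set of those $\Phi$ with: $\phi_\xi$ a $C^r$-diffeomorphism (homeomorphism if $r=0$); $\lambda\|x-y\|<\|\phi_\xi(x)-\phi_\xi(y)\|<\beta\|x-y\|$ for $x\ne y$ in $\overline D$; for some $C\ge 0$, $\|\phi_\xi^{\pm1}(x)-\phi_\zeta^{\pm1}(x)\|\le C\,d_\Sigma(\xi,\zeta)^\alpha$ whenever $x\in\overline D$ and $\xi_0=\zeta_0$ (the least such $C$ is denoted $C_\Phi$); and $\phi_\xi(\overline D)\subset D$ if $\beta<1$, $\overline D\subset\phi_\xi(D)$ if $\lambda>1$. It carries the distance $\sup_\xi d_{C^r}(\phi_\xi,\psi_\xi)+|C_\Phi-C_\Psi|$, where $d_{C^0}$ is the uniform distance on $\overline D$ and $d_{C^1}$ (used for $D=M$) is a distance of the $C^1$ topology. $\mathcal{PHS}^{1,\alpha}_{d,\lambda,\beta}(M)$ is $\mathcal S^{1,\alpha}_{d,\lambda,\beta}(M)$ with $\nu^\alpha<\lambda<1<\beta<\nu^{-\alpha}$. A property is *$\mathcal S^{1,\alpha}$-robust* at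 $\hat\Phi\in\mathcal{PHS}^{1,\alpha}_{d,\lambda,\beta}(M)$ if it holds for all $\hat\Psi$ in a neighbourhood of $\hat\Phi$ in this space, fixed points being replaced by their continuations $(\vartheta,p_{\hat\Psi})$, $p_{\hat\Psi}$ being the unique fixed point of $\psi_\vartheta$ in some fixed neighbourhood of $p$. $C^1$-robustness for a $C^1$-diffeomorphism of $M$ is defined likewise, with the $C^1$ topology on $\mathrm{Diff}^1(M)$. The *stable set* $W^s(z;\Phi)$ (*unstable set* $W^u(z;\Phi)$) is the set of points whose forward (backward) orbits are asymptotic to that of $z$; stable and unstable manifolds of fixed points in $M$ are defined likewise. A fixed point in $M$ is *attracting* (*repelling*) if all eigenvalues of the derivative there have modulus $<1$ ($>1$). $\Phi$ is *topologically mixing* if for all nonempty open $U,V\subset\Sigma_m\times M$ there is $n_0$ with $\Phi^n(U)\cap V\ne\emptyset$ for all $n\ge n_0$. *Symbolic cs-blender.* Let $\Phi\in\mathcal S^{0,\alpha}_{k,\lambda',\beta'}(D)$ with $D$ open, $0<\lambda'<\beta'<1$, and let $\Gamma_\Phi=\bigcap_{n\in\mathbb Z}\Phi^n(\Sigma_k\times\overline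 D)$. For $\delta>0$, a *$\delta$-horizontal disk* in $\Sigma_k\times B'$ is the graph of a function $h:W^s_{loc}(\zeta;\tau)\to B'$ that is $\alpha$-Hölder with a constant $C$ such that $C\nu^\alpha<\delta$ and satisfies $\|z-h(\xi)\|<\delta$ for all $\xi$, for some $(\zeta,z)\in\Sigma_k\times B'$. The local strong unstable set $W^{uu}_{loc}((\xi,x);\Psi)$ consists of the $(\zeta,y)$ with $\zeta\in W^u_{loc}(\xi;\tau)$ such that the $M$-components of $\Psi^{-n}(\zeta,y)$ and $\Psi^{-n}(\xi,x)$ are at distance $O(\nu^{\alpha n})$, $n\ge0$; $W^{uu}_{loc}(\Gamma;\Psi)$ is the union of these sets over the points of $\Gamma$. $\Gamma_\Phi$ is a *symbolic cs-blender with superposition domain $B'$*, where $B'\subset D$ is open and nonempty, if there are $\delta>0$ and a neighbourhood $\mathcal V$ of $\Phi$ in $\mathcal S^{0,\alpha}_{k,\lambda',\beta'}(D)$ such that $W^{uu}_{loc}(\Gamma_\Psi;\Psi)\cap H\neq\emptyset$ for every $\Psi\in\mathcal V$ and every $\delta$-horizontal disk $H$ in $\Sigma_k\times B'$. **Theorem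 5.7.** Let $\hat\Phi=\tau\times(\phi_1,\dots,\phi_d)\in\mathcal{PHS}^{1,\alpha}_{d,\lambda,\beta}(M)$ be a one-step map, $d>k$. Assume that the restriction $\Phi=\hat\Phi|_{\Sigma_k\times M}=\tau\times(\phi_1,\dots,\phi_k)$ has a symbolic cs-blender $\Gamma_\Phi^{cs}\subset\Sigma_k\times M$ whose superposition domain contains an open set $B\subset M$ with $\overline B\subset\phi_1(B)\cup\dots\cup\phi_k(B)$. Assume that $\phi_1$ has an attracting fixed point in $B$ whose stable manifold is $C^1$-robustly dense in $M$, and that $\phi_{k+1}$ has a repelling fixed point in $B$ whose unstable manifold is $C^1$-robustly dense in $M$. Then there is a fixed point $(\vartheta,p)\in\Gamma_\Phi^{cs}$ of $\hat\Phi$ whose stable and unstable sets $W^s((\vartheta,p);\hat\Phi)$ and $W^u((\vartheta,p);\hat\Phi)$ are $\mathcal S^{1,\alpha}$-robustly dense in $\Sigma_d\times M$. Moreover $\hat\Phi$ is $\mathcal S^{1,\alpha}$-robustly topologically mixing. -/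

import Mathlib

open Set Filter Topology Bundle
open scoped Manifold ContDiff

namespace SymbolicSkew

/-! ### The full shift -/

/-- Bi-infinite sequences in `d` symbols; the symbols `1, …, d` are the elements `0, …, d - 1` of
`Fin d`. The topology is the product topology. -/
abbrev Seq (d : ℕ) : Type := ℤ → Fin d

/-- The shift `(τ ξ)_i = ξ_{i+1}`. -/
def shift (d : ℕ) : Seq d ≃ Seq d where
  toFun ξ := fun i => ξ (i + 1)
  invFun ξ := fun i => ξ (i - 1)
  left_inv ξ := by funext i; simp
  right_inv ξ := by funext i; simp

open Classical in
/-- The metric `ν ^ ℓ`, `ℓ = min {i ≥ 0 : ξ_i ≠ ζ_i or ξ_{-i} ≠ ζ_{-i}}`, on sequences. -/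
noncomputable def seqDist (ν : ℝ) {d : ℕ} (ξ ζ : Seq d) : ℝ :=
  if ξ = ζ then 0
  else ν ^ sInf {i : ℕ | ξ (i : ℤ) ≠ ζ (i : ℤ) ∨ ξ (-(i : ℤ)) ≠ ζ (-(i : ℤ))}

/-- Local stable set of `ξ` for the shift. -/
def locStable {d : ℕ} (ξ : Seq d) : Set (Seq d) := {ζ | ∀ i : ℤ, 0 ≤ i → ζ i = ξ i}

/-- Local unstable set of `ξ` for the shift. -/
def locUnstable {d : ℕ} (ξ : Seq d) : Set (Seq d) := {ζ | ∀ i : ℤ, i ≤ 0 → ζ i = ξ i}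

/-- The inclusion of the sequences in the first `k` symbols into the sequences in `d` symbols. -/
def inclSeq {k d : ℕ} (h : k ≤ d) (ξ : Seq k) : Seq d := fun i => Fin.castLE h (ξ i)

/-! ### Symbolic skew-products -/

/-- A symbolic skew-product over the shift of `d` symbols: the fibre maps are homeomorphisms of `M`
depending continuously on the base point. -/
structure SkewProduct (d : ℕ) (M : Type*) [TopologicalSpace M] where
  fiber : Seq d → M ≃ₜ M
  continuous_fiber : Continuous fun z : Seq d × M => fiber z.1 z.2

namespace SkewProduct

section Dynamics

variable {d : ℕ} {M : Type*} [TopologicalSpace M]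

/-- The bijection `Φ (ξ, x) = (τ ξ, φ_ξ x)` of `Σ_d × M`. -/
def map (Φ : SkewProduct d M) : Equiv.Perm (Seq d × M) where
  toFun z := (shift d z.1, Φ.fiber z.1 z.2)
  invFun z := ((shift d).symm z.1, (Φ.fiber ((shift d).symm z.1)).symm z.2)
  left_inv z := by simp
  right_inv z := by simp

/-- The maximal invariant set `⋂_{n ∈ ℤ} Φⁿ (Σ_d × closure D)`. -/
def maxInvariant (Φ : SkewProduct d M) (D : Set M) : Set (Seq d × M) :=
  ⋂ n : ℤ, (Φ.map ^ n) '' (univ ×ˢ closure D)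

/-- Topological mixing on `Σ_d × M`. -/
def TopMixing (Φ : SkewProduct d M) : Prop :=
  ∀ U V : Set (Seq d × M), IsOpen U → IsOpen V → U.Nonempty → V.Nonempty →
    ∃ n₀ : ℕ, ∀ n : ℕ, n₀ ≤ n → (((Φ.map ^ n) '' U) ∩ V).Nonempty

end Dynamics

section Metric

variable {d : ℕ} {M : Type*} [MetricSpace M]

/-- The product metric on `Σ_d × M`. -/
noncomputable def pairDist (ν : ℝ) (z w : Seq d × M) : ℝ :=
  max (seqDist ν z.1 w.1) (dist z.2 w.2)

/-- The stable set of `z`: points whose forward orbits are asymptotic to that of `z`. -/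
def stableSet (ν : ℝ) (Φ : SkewProduct d M) (z : Seq d × M) : Set (Seq d × M) :=
  {w | Tendsto (fun n : ℕ => pairDist ν ((Φ.map ^ n) w) ((Φ.map ^ n) z)) atTop (𝓝 0)}

/-- The unstable set of `z`: points whose backward orbits are asymptotic to that of `z`. -/
def unstableSet (ν : ℝ) (Φ : SkewProduct d M) (z : Seq d × M) : Set (Seq d × M) :=
  {w | Tendsto (fun n : ℕ => pairDist ν ((Φ.map.symm ^ n) w) ((Φ.map.symm ^ n) z)) atTop (𝓝 0)}

/-- The fibre maps and their inverses are, on `closure D`, locally `α`-Hölder in the base point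
with constant `C`. -/
def IsLocHolderWith (ν α : ℝ) (D : Set M) (Φ : SkewProduct d M) (C : ℝ) : Prop :=
  0 ≤ C ∧ ∀ ξ ζ : Seq d, ξ 0 = ζ 0 → ∀ x ∈ closure D,
    dist (Φ.fiber ξ x) (Φ.fiber ζ x) ≤ C * seqDist ν ξ ζ ^ α ∧
    dist ((Φ.fiber ξ).symm x) ((Φ.fiber ζ).symm x) ≤ C * seqDist ν ξ ζ ^ α

/-- The local Hölder constant `C_Φ` on `closure D`: the smallest admissible one. -/
noncomputable def holderConst (ν α : ℝ) (D : Set M) (Φ : SkewProduct d M) : ℝ :=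
  sInf {C | IsLocHolderWith ν α D Φ C}

/-- A map is `(lam, bet)`-Lipschitz on a set. -/
def IsBiLip (lam bet : ℝ) (s : Set M) (f : M → M) : Prop :=
  ∀ x ∈ s, ∀ y ∈ s, x ≠ y →
    lam * dist x y < dist (f x) (f y) ∧ dist (f x) (f y) < bet * dist x y

/-- Membership in the set `𝒮` of symbolic skew-products with `(lam, bet)`-Lipschitz fibre maps on
`closure D` that depend locally `α`-Hölder continuously on the base point, with the standing
convention on contracting and on expanding fibre maps. (Continuity of the fibre maps is part of
`SkewProduct`; higher smoothness is imposed separately.) -/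
structure MemS (ν α lam bet : ℝ) (D : Set M) (Φ : SkewProduct d M) : Prop where
  biLip : ∀ ξ, IsBiLip lam bet (closure D) (Φ.fiber ξ)
  holder : ∃ C, IsLocHolderWith ν α D Φ C
  contracting : bet < 1 → ∀ ξ, Φ.fiber ξ '' closure D ⊆ D
  expanding : 1 < lam → ∀ ξ, closure D ⊆ Φ.fiber ξ '' D

/-- The distance on `𝒮` for `C⁰` fibre maps:
`sup_ξ sup_{x ∈ closure D} dist (φ_ξ x) (ψ_ξ x) + |C_Φ - C_Ψ|`. -/
noncomputable def distS (ν α : ℝ) (D : Set M) (Φ Ψ : SkewProduct d M) : ℝ :=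
  (⨆ ξ : Seq d, ⨆ x : closure D, dist (Φ.fiber ξ x) (Ψ.fiber ξ x)) +
    |holderConst ν α D Φ - holderConst ν α D Ψ|

/-- The local strong unstable set of `z = (ξ, x)`: the points `(ζ, y)` over the local unstable set
of `ξ` with `dist (Φ⁻ⁿ(ζ, y)) (Φ⁻ⁿ(ξ, x)) = O(ν^{αn})` in the fibre. This is the leaf through `z` of
the invariant partition into graphs of `α`-Hölder functions over local unstable sets. -/
def locStrongUnstable (ν α : ℝ) (Φ : SkewProduct d M) (z : Seq d × M) : Set (Seq d × M) :=
  {w | w.1 ∈ locUnstable z.1 ∧ ∃ K : ℝ, ∀ n : ℕ,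
    dist ((Φ.map.symm ^ n) w).2 ((Φ.map.symm ^ n) z).2 ≤ K * (ν ^ α) ^ n}

/-- The local strong unstable set of an invariant set. -/
def locStrongUnstableOf (ν α : ℝ) (Φ : SkewProduct d M) (Γ : Set (Seq d × M)) :
    Set (Seq d × M) :=
  ⋃ z ∈ Γ, locStrongUnstable ν α Φ z

/-- `H` is an almost `δ`-horizontal disk in `Σ_d × B`: the graph of an `(α, C)`-Hölder function
`h : locStable ζ → B` that is `δ`-close to a point `z ∈ B`, with `C ν^α < δ`. -/
def IsHorizontalDisk (ν α δ : ℝ) (B : Set M) (H : Set (Seq d × M)) : Prop :=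
  ∃ (ζ : Seq d) (z : M) (C : ℝ) (h : Seq d → M), z ∈ B ∧ 0 ≤ C ∧ C * ν ^ α < δ ∧
    (∀ ξ ∈ locStable ζ, h ξ ∈ B ∧ dist z (h ξ) < δ) ∧
    (∀ ξ ∈ locStable ζ, ∀ ξ' ∈ locStable ζ, dist (h ξ) (h ξ') ≤ C * seqDist ν ξ ξ' ^ α) ∧
    H = (fun ξ => (ξ, h ξ)) '' locStable ζ

/-- The maximal invariant set of `Φ` in `Σ_d × closure D` is a symbolic cs-blender(-horseshoe)
whose superposition domain `B'` contains `B`. -/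
def IsCsBlender (ν α lam bet : ℝ) (D B : Set M) (Φ : SkewProduct d M) : Prop :=
  IsOpen D ∧ 0 < lam ∧ lam < bet ∧ bet < 1 ∧ MemS ν α lam bet D Φ ∧
  ∃ B' : Set M, IsOpen B' ∧ B'.Nonempty ∧ B' ⊆ D ∧ B ⊆ B' ∧
    ∃ δ > 0, ∃ ε > 0, ∀ Ψ : SkewProduct d M, MemS ν α lam bet D Ψ → distS ν α D Φ Ψ < ε →
      ∀ H : Set (Seq d × M), IsHorizontalDisk ν α δ B' H →
        (locStrongUnstableOf ν α Ψ (Ψ.maxInvariant D) ∩ H).Nonempty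

end Metric

end SkewProduct

/-! ### `C¹` diffeomorphisms -/

section Smooth

variable {n : ℕ} {M : Type*} [MetricSpace M] [ChartedSpace (EuclideanSpace ℝ (Fin n)) M]
  [IsManifold (𝓡 n) ∞ M]

/-- `Diff¹(M)`. -/
abbrev Diff1 (n : ℕ) (M : Type*) [MetricSpace M] [ChartedSpace (EuclideanSpace ℝ (Fin n)) M] :
    Type _ :=
  M ≃ₘ^1⟮𝓡 n, 𝓡 n⟯ M

/-- The tangent map of a `C¹` diffeomorphism, as a continuous self-map of the tangent bundle. -/
noncomputable def Diff1.tangent (f : Diff1 n M) :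
    C(TangentBundle (𝓡 n) M, TangentBundle (𝓡 n) M) where
  toFun := tangentMap (𝓡 n) (𝓡 n) f
  continuous_toFun := f.contMDiff.continuous_tangentMap le_rfl

/-- The `C¹` topology on `Diff¹(M)`: uniform convergence on compact sets of the tangent maps. -/
noncomputable instance Diff1.topology : TopologicalSpace (Diff1 n M) :=
  TopologicalSpace.induced Diff1.tangent inferInstance

/-- The derivative of `f` at a point `p` (to be used at fixed points), as an endomorphism of the
model space, i.e. of the tangent space at `p` in the preferred chart. -/
noncomputable def Diff1.derivAt (f : Diff1 n M) (p : M) :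
    EuclideanSpace ℝ (Fin n) →ₗ[ℝ] EuclideanSpace ℝ (Fin n) :=
  (show EuclideanSpace ℝ (Fin n) →L[ℝ] EuclideanSpace ℝ (Fin n) from
    mfderiv (𝓡 n) (𝓡 n) f p).toLinearMap

/-- Attracting fixed point: all eigenvalues of the derivative have modulus `< 1`. -/
def Diff1.IsAttracting (f : Diff1 n M) (p : M) : Prop :=
  f p = p ∧ ∀ z : ℂ, Polynomial.aeval z (f.derivAt p).charpoly = 0 → ‖z‖ < 1

/-- Repelling fixed point: all eigenvalues of the derivative have modulus `> 1`. -/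
def Diff1.IsRepelling (f : Diff1 n M) (p : M) : Prop :=
  f p = p ∧ ∀ z : ℂ, Polynomial.aeval z (f.derivAt p).charpoly = 0 → 1 < ‖z‖

/-- Stable manifold of a fixed point `p` of `f`. -/
def Diff1.stableManifold (f : Diff1 n M) (p : M) : Set M :=
  {y | Tendsto (fun m : ℕ => dist (f^[m] y) p) atTop (𝓝 0)}

/-- Unstable manifold of a fixed point `p` of `f`. -/
def Diff1.unstableManifold (f : Diff1 n M) (p : M) : Set M :=
  {y | Tendsto (fun m : ℕ => dist (f.symm^[m] y) p) atTop (𝓝 0)}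

/-- For a (hyperbolic) fixed point `p` of `f`: the continuation of `p` (the unique fixed point in a
fixed neighbourhood `W` of `p`) for every `g` that is `C¹`-close to `f` has a dense stable
manifold. -/
def Diff1.StableRobustlyDense (f : Diff1 n M) (p : M) : Prop :=
  ∃ W ∈ 𝓝 p, ∀ᶠ g in 𝓝 f, ∃ p' ∈ W, (∀ x ∈ W, g x = x ↔ x = p') ∧
    Dense (Diff1.stableManifold g p')

/-- The same for the unstable manifold. -/
def Diff1.UnstableRobustlyDense (f : Diff1 n M) (p : M) : Prop :=
  ∃ W ∈ 𝓝 p, ∀ᶠ g in 𝓝 f, ∃ p' ∈ W, (∀ x ∈ W, g x = x ↔ x = p') ∧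
    Dense (Diff1.unstableManifold g p')

/-! ### Skew-products with `C¹` fibre maps and robustness -/

/-- A symbolic skew-product whose fibre maps are `C¹` diffeomorphisms. -/
structure C1SkewProduct (d n : ℕ) (M : Type*) [MetricSpace M]
    [ChartedSpace (EuclideanSpace ℝ (Fin n)) M] where
  fiber : Seq d → Diff1 n M
  continuous_fiber : Continuous fun z : Seq d × M => fiber z.1 z.2

/-- The underlying skew-product. -/
noncomputable def C1SkewProduct.toSkewProduct {d : ℕ} (Ψ : C1SkewProduct d n M) : SkewProduct d M where
  fiber ξ := (Ψ.fiber ξ).toHomeomorph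
  continuous_fiber := Ψ.continuous_fiber

/-- The one-step skew-product with fibre maps `φ_{ξ_0}`. -/
noncomputable def oneStep {d : ℕ} (φ : Fin d → Diff1 n M) : C1SkewProduct d n M where
  fiber ξ := φ (ξ 0)
  continuous_fiber := by
    have h : ∀ i : Fin d, Continuous (φ i) := fun i => (φ i).continuous
    have h1 : Continuous fun w : Fin d × M => φ w.1 w.2 :=
      continuous_prod_of_discrete_left.2 h
    have h2 : Continuous fun z : Seq d × M => (z.1 0, z.2) :=
      ((continuous_apply (0 : ℤ)).comp continuous_fst).prodMk continuous_snd
    exact h1.comp h2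

/-- Partially hyperbolic symbolic skew-products with `C¹` fibre maps on `Σ_d × M`. -/
def MemPHS (ν α lam bet : ℝ) {d : ℕ} (Ψ : C1SkewProduct d n M) : Prop :=
  ν ^ α < lam ∧ lam < 1 ∧ 1 < bet ∧ bet < ν ^ (-α) ∧ Ψ.toSkewProduct.MemS ν α lam bet univ

/-- The property `P` holds `𝒮^{1,α}`-robustly at the one-step map with fibre maps `φ_1, …, φ_d`,
i.e. for all partially hyperbolic skew-products `Ψ` in a neighbourhood of it for the distance
`sup_ξ d_{C¹}(φ_ξ, ψ_ξ) + |C_Φ - C_Ψ|`. As `φ_ξ = φ_{ξ_0}` takes finitely many values and `C_Φ = 0`,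
such neighbourhoods are given by `C¹`-neighbourhoods `U_i` of the `φ_i` and by an `ε > 0`: the
conditions are `ψ_ξ ∈ U_{ξ_0}` for all `ξ`, and `C_Ψ < ε`. -/
def RobustlyAt (ν α lam bet : ℝ) {d : ℕ} (φ : Fin d → Diff1 n M)
    (P : C1SkewProduct d n M → Prop) : Prop :=
  ∃ U : Fin d → Set (Diff1 n M), (∀ i, U i ∈ 𝓝 (φ i)) ∧ ∃ ε > 0,
    ∀ Ψ : C1SkewProduct d n M, MemPHS ν α lam bet Ψ → (∀ ξ, Ψ.fiber ξ ∈ U (ξ 0)) →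
      Ψ.toSkewProduct.holderConst ν α univ < ε → P Ψ

/-- For a fixed point `(ϑ, p)` of the one-step map with fibre maps `φ_i`: robustly, the continuation
`(ϑ, p')` of `(ϑ, p)` (`p'` being the unique fixed point of `ψ_ϑ` in a fixed neighbourhood `W` of
`p`) has a dense stable set. -/
def StableSetRobustlyDense (ν α lam bet : ℝ) {d : ℕ} (φ : Fin d → Diff1 n M)
    (ϑ : Seq d) (p : M) : Prop :=
  ∃ W ∈ 𝓝 p, RobustlyAt ν α lam bet φ fun Ψ =>
    ∃ p' ∈ W, (∀ x ∈ W, Ψ.toSkewProduct.map (ϑ, x) = (ϑ, x) ↔ x = p') ∧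
      Dense (Ψ.toSkewProduct.stableSet ν (ϑ, p'))

/-- The same for the unstable set. -/
def UnstableSetRobustlyDense (ν α lam bet : ℝ) {d : ℕ} (φ : Fin d → Diff1 n M)
    (ϑ : Seq d) (p : M) : Prop :=
  ∃ W ∈ 𝓝 p, RobustlyAt ν α lam bet φ fun Ψ =>
    ∃ p' ∈ W, (∀ x ∈ W, Ψ.toSkewProduct.map (ϑ, x) = (ϑ, x) ↔ x = p') ∧
      Dense (Ψ.toSkewProduct.unstableSet ν (ϑ, p'))

end Smooth

end SymbolicSkew

namespace SymbolicSkew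

/-! Write `s` for the first symbol, `t` for the symbol of the repelling point, `S` for the first `k`
symbols and `K = closure D`. A perturbation `Ψ` is no longer one-step: its fibre maps depend on the
whole sequence, though only through a small Hölder constant `C`. The domination `ν ^ α < lam`, `bet
< ν ^ (-α)` makes this dependence harmless. If the past of a sequence is changed and the end point
of an orbit segment is kept, the initial point moves by at most `C / (lam - ν ^ α)`, whatever the
length of the segment (`IsDominated.dist_le_of_fwd_eq`).

Stable set: in the fibre over `s^∞` the points attracted by the continuation `p'` are dense. By
shadowing (`dense_tendsto_seqIter`) the same holds in every fibre whose future is eventually `s`,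
and such fibres are dense.

Unstable set: let `V` be open. Prescribing the remote past `t`, some point of `V` has a backward
orbit that reaches a small ball around the continuation `q'` of the repelling point, inside `B`.
From there the covering of `closure B` allows pulling back within `B` along symbols of `S` for as
long as desired. Since these symbols contract `K`, a long pull-back makes the image of the whole
fibre `{ζ} × K` small enough to lie in `V`. Here `ζ` can be given the constant past `s`
(`exists_forall_map_pow_mem`), so that `{ζ} × K` contains a point asymptotic in the past to `(s^∞,
p')`.

Mixing: an orbit from `U` that enters `K` near `p'` waits there along the symbol `s` for an
arbitrary time and then follows `ζ` into `V`.

The hypotheses of these arguments are `C¹`-open. Contraction on `K` persists through derivative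
bounds along almost minimizing paths (`eventually_dist_le_mul`), the covering persists by a Lebesgue
number, and the continuations stay near the original fixed points by trapping regions. -/

/-! ### Compositions of sequences of maps -/

/-- The composition `f_{n-1} ∘ ⋯ ∘ f_0`. -/
def seqIter {X : Type*} (f : ℕ → X → X) : ℕ → X → X
  | 0 => id
  | n + 1 => f n ∘ seqIter f n

section SeqIter

variable {X : Type*}

@[simp] lemma seqIter_zero (f : ℕ → X → X) (x : X) : seqIter f 0 x = x := rfl

lemma seqIter_succ (f : ℕ → X → X) (n : ℕ) (x : X) :
    seqIter f (n + 1) x = f n (seqIter f n x) := rfl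

lemma seqIter_add (f : ℕ → X → X) (m n : ℕ) (x : X) :
    seqIter f (m + n) x = seqIter (fun j => f (m + j)) n (seqIter f m x) := by
  induction n with
  | zero => rfl
  | succ n ih => rw [← add_assoc, seqIter_succ, seqIter_succ, ih]

lemma seqIter_const (f : X → X) (n : ℕ) (x : X) : seqIter (fun _ => f) n x = f^[n] x := by
  induction n with
  | zero => rfl
  | succ n ih => rw [seqIter_succ, ih, Function.iterate_succ_apply']

lemma seqIter_surjective {f : ℕ → X → X} (h : ∀ n, Function.Surjective (f n)) (n : ℕ) :
    Function.Surjective (seqIter f n) := by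
  induction n with
  | zero => exact Function.surjective_id
  | succ n ih => exact (h n).comp ih

lemma seqIter_continuous [TopologicalSpace X] {f : ℕ → X → X} (h : ∀ n, Continuous (f n))
    (n : ℕ) : Continuous (seqIter f n) := by
  induction n with
  | zero => exact continuous_id
  | succ n ih => exact (h n).comp ih

variable [MetricSpace X]

lemma dist_seqIter_le {f : ℕ → X → X} {L : ℝ} (hL : 0 ≤ L)
    (h : ∀ n x y, dist (f n x) (f n y) ≤ L * dist x y) (n : ℕ) (x y : X) :
    dist (seqIter f n x) (seqIter f n y) ≤ L ^ n * dist x y := by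
  induction n with
  | zero => simp
  | succ n ih =>
    calc _ ≤ L * dist (seqIter f n x) (seqIter f n y) := h n _ _
      _ ≤ L * (L ^ n * dist x y) := by gcongr
      _ = _ := by ring

lemma le_dist_seqIter {f : ℕ → X → X} {c : ℝ} (hc : 0 ≤ c)
    (h : ∀ n x y, c * dist x y ≤ dist (f n x) (f n y)) (n : ℕ) (x y : X) :
    c ^ n * dist x y ≤ dist (seqIter f n x) (seqIter f n y) := by
  induction n with
  | zero => simp
  | succ n ih =>
    calc _ = c * (c ^ n * dist x y) := by ring
      _ ≤ c * dist (seqIter f n x) (seqIter f n y) := by gcongr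
      _ ≤ _ := h n _ _

/-- If `f_n` and `g_n` are exponentially close, at a rate smaller than the least expansion of the
`f_n`, then orbit segments with the same end point are exponentially close. -/
lemma dist_seqIter_le_of_eq {f g : ℕ → X → X} {c C θ : ℝ} (hc : θ < c) (hθ : 0 < θ)
    (hC : 0 ≤ C)
    (hf : ∀ n x y, c * dist x y ≤ dist (f n x) (f n y))
    (hfg : ∀ n x, dist (f n x) (g n x) ≤ C * θ ^ n) {N : ℕ} {x y : X}
    (hxy : seqIter f N x = seqIter g N y) {j : ℕ} (hj : j ≤ N) :
    dist (seqIter f j x) (seqIter g j y) ≤ C / (c - θ) * θ ^ j := by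
  have hpos : 0 < c - θ := by linarith
  induction hj using Nat.decreasingInduction with
  | self => rw [hxy, dist_self]; positivity
  | of_succ j hj ih =>
    have h1 := hf j (seqIter f j x) (seqIter g j y)
    have h2 := dist_triangle (f j (seqIter f j x)) (g j (seqIter g j y)) (f j (seqIter g j y))
    have h3 := hfg j (seqIter g j y)
    rw [dist_comm] at h3
    rw [seqIter_succ, seqIter_succ] at ih
    -- The constant `K = C / (c - θ)` solves `c * K = θ * K + C`, so the bound reproduces itself
    -- under backward induction from the common end point.
    have h4 : c * (C / (c - θ) * θ ^ j) = C / (c - θ) * θ ^ (j + 1) + C * θ ^ j := by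
      field_simp; ring
    exact le_of_mul_le_mul_left (by linarith) (hθ.trans hc)

/-- Every orbit of `f` is shadowed, at an exponential rate, by an orbit of `g`. -/
lemma exists_shadow [CompactSpace X] {f g : ℕ → X → X} {c C θ : ℝ} (hc : θ < c) (hθ : 0 < θ)
    (hC : 0 ≤ C)
    (hf : ∀ n x y, c * dist x y ≤ dist (f n x) (f n y))
    (hfg : ∀ n x, dist (f n x) (g n x) ≤ C * θ ^ n)
    (hg : ∀ n, Continuous (g n)) (hg' : ∀ n, Function.Surjective (g n)) (x : X) :
    ∃ y, ∀ n, dist (seqIter f n x) (seqIter g n y) ≤ C / (c - θ) * θ ^ n := by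
  -- Points that shadow up to time `n`. Such a point exists because a preimage of the end point of
  -- the `f`-orbit under `seqIter g n` gives a segment with the same end point; compactness then
  -- gives one point for all times.
  let S : ℕ → Set X := fun n => {y | ∀ j ≤ n,
    dist (seqIter f j x) (seqIter g j y) ≤ C / (c - θ) * θ ^ j}
  have hS : ∀ n, IsClosed (S n) := by
    intro n
    have : S n = ⋂ j ∈ Iic n,
        {y | dist (seqIter f j x) (seqIter g j y) ≤ C / (c - θ) * θ ^ j} := by
      ext y; simp [S]
    rw [this]
    refine isClosed_biInter fun j _ => isClosed_le ?_ continuous_const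
    exact continuous_const.dist (seqIter_continuous hg j)
  obtain ⟨y, hy⟩ := IsCompact.nonempty_iInter_of_sequence_nonempty_isCompact_isClosed S
    (fun n y hy j hj => hy j (by omega))
    (fun n => by
      obtain ⟨y, hy⟩ := seqIter_surjective hg' n (seqIter f n x)
      exact ⟨y, fun j hj => dist_seqIter_le_of_eq hc hθ hC hf hfg hy.symm hj⟩)
    (hS 0).isCompact hS
  exact ⟨y, fun n => mem_iInter.1 hy n n le_rfl⟩

/-- Density of the set of points whose orbit tends to `a` is inherited by exponentially close
sequences of maps. -/
lemma dense_tendsto_seqIter [CompactSpace X] {f g : ℕ → X → X} {c C θ L : ℝ} (hc : θ < c)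
    (hθ : 0 < θ) (hθ1 : θ < 1) (hC : 0 ≤ C)
    (hf : ∀ n x y, c * dist x y ≤ dist (f n x) (f n y))
    (hg : ∀ n x y, c * dist x y ≤ dist (g n x) (g n y))
    (hL : 0 ≤ L) (hfL : ∀ n x y, dist (f n x) (f n y) ≤ L * dist x y)
    (hfg : ∀ n x, dist (f n x) (g n x) ≤ C * θ ^ n)
    (hfc : ∀ n, Continuous (f n)) (hfs : ∀ n, Function.Surjective (f n))
    (hgc : ∀ n, Continuous (g n)) (hgs : ∀ n, Function.Surjective (g n)) {a : X}
    (hd : Dense {x | Tendsto (fun n => seqIter f n x) atTop (𝓝 a)}) :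
    Dense {x | Tendsto (fun n => seqIter g n x) atTop (𝓝 a)} := by
  have hgf : ∀ n x, dist (g n x) (f n x) ≤ C * θ ^ n := fun n x => by
    rw [dist_comm]; exact hfg n x
  have hc0 : 0 < c := hθ.trans hc
  set K := C / (c - θ) with hK
  rw [Metric.dense_iff]
  intro v ε hε
  -- Shadowing may move the initial point by as much as `K`, so `y` is compared with `v` at a late
  -- time `n` instead. There the distance is at most `2 * K * θ ^ n` plus a term as small as
  -- desired, and dividing by `c ^ n` makes it small because `θ < c`.
  obtain ⟨x, hx⟩ := exists_shadow hc hθ hC hg hgf hfc hfs v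
  have hlim : Tendsto (fun n : ℕ => 2 * K * (θ / c) ^ n) atTop (𝓝 0) := by
    have := tendsto_pow_atTop_nhds_zero_of_lt_one (div_nonneg hθ.le hc0.le)
      ((div_lt_one hc0).2 hc)
    simpa using this.const_mul (2 * K)
  obtain ⟨n, hn⟩ := (hlim.eventually_lt_const (half_pos hε)).exists
  have hpos : 0 < c ^ n * (ε / 2) := by positivity
  obtain ⟨η, hη, hηL⟩ : ∃ η > 0, L ^ n * η < c ^ n * (ε / 2) := by
    refine ⟨c ^ n * (ε / 2) / (L ^ n + 1), by positivity, ?_⟩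
    rw [mul_div_assoc', div_lt_iff₀ (by positivity)]
    nlinarith
  obtain ⟨x', hx'ball, hx'⟩ := Metric.dense_iff.1 hd x η hη
  obtain ⟨y, hy⟩ := exists_shadow hc hθ hC hf hfg hgc hgs x'
  refine ⟨y, ?_, ?_⟩
  · have h1 := le_dist_seqIter hc0.le hg n y v
    have h2 := dist_triangle4 (seqIter g n y) (seqIter f n x') (seqIter f n x) (seqIter g n v)
    have h3 := hy n
    have h4 := hx n
    have h5 := dist_seqIter_le hL hfL n x' x
    have h6 : L ^ n * dist x' x ≤ L ^ n * η := by
      gcongr; exact (Metric.mem_ball.1 hx'ball).le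
    rw [dist_comm] at h3 h4
    have h7 : 2 * K * θ ^ n = c ^ n * (2 * K * (θ / c) ^ n) := by
      rw [div_pow]; field_simp
    have h8 : c ^ n * (2 * K * (θ / c) ^ n) < c ^ n * (ε / 2) := by gcongr
    rw [Metric.mem_ball]
    refine lt_of_mul_lt_mul_left (?_ : c ^ n * dist y v < c ^ n * ε) (by positivity)
    linarith
  · have h0 : Tendsto (fun n => K * θ ^ n) atTop (𝓝 0) := by
      simpa using (tendsto_pow_atTop_nhds_zero_of_lt_one hθ.le hθ1).const_mul K
    have h1 : Tendsto (fun n => dist (seqIter f n x') (seqIter g n y)) atTop (𝓝 0) :=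
      squeeze_zero (fun _ => dist_nonneg) hy h0
    exact (tendsto_iff_of_dist h1).1 hx'

end SeqIter

/-! ### Powers of the shift -/

/-- The `n`-th power of the shift. -/
def shiftBy {d : ℕ} (n : ℤ) (ξ : Seq d) : Seq d := fun i => ξ (i + n)

section ShiftBy

variable {d : ℕ}

@[simp] lemma shiftBy_apply (n i : ℤ) (ξ : Seq d) : shiftBy n ξ i = ξ (i + n) := rfl

@[simp] lemma shiftBy_zero (ξ : Seq d) : shiftBy 0 ξ = ξ := by
  funext i; simp

lemma shiftBy_shiftBy (m n : ℤ) (ξ : Seq d) : shiftBy m (shiftBy n ξ) = shiftBy (n + m) ξ := by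
  funext i; simp only [shiftBy_apply]; congr 1; ring

lemma shiftBy_const (n : ℤ) (s : Fin d) : shiftBy n (fun _ => s) = fun _ => s := rfl

lemma seqDist_nonneg {ν : ℝ} (hν : 0 < ν) (ξ ζ : Seq d) : 0 ≤ seqDist ν ξ ζ := by
  unfold seqDist; split_ifs <;> positivity

lemma seqDist_le {ν : ℝ} (hν : 0 < ν) (hν1 : ν < 1) {ξ ζ : Seq d} {m : ℕ}
    (h : ∀ j : ℤ, j.natAbs < m → ξ j = ζ j) : seqDist ν ξ ζ ≤ ν ^ m := by
  unfold seqDist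
  split_ifs with hne
  · positivity
  · refine pow_le_pow_of_le_one hν.le hν1.le (le_csInf ?_ ?_)
    · obtain ⟨i, hi⟩ := Function.ne_iff.1 hne
      refine ⟨i.natAbs, ?_⟩
      rcases Int.natAbs_eq i with h | h
      · left; rwa [← h]
      · right; rwa [← h]
    · intro i hi
      by_contra! hlt
      rcases hi with hi | hi
      · exact hi (h _ (by simpa using hlt))
      · exact hi (h _ (by simpa using hlt))

lemma seqDist_rpow_le {ν α : ℝ} (hν : 0 < ν) (hν1 : ν < 1) (hα : 0 < α) {ξ ζ : Seq d} {m : ℕ}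
    (h : ∀ j : ℤ, j.natAbs < m → ξ j = ζ j) : seqDist ν ξ ζ ^ α ≤ (ν ^ α) ^ m := by
  calc seqDist ν ξ ζ ^ α ≤ (ν ^ m) ^ α :=
        Real.rpow_le_rpow (seqDist_nonneg hν _ _) (seqDist_le hν hν1 h) hα.le
    _ = (ν ^ α) ^ m := (Real.rpow_pow_comm hν.le α m).symm

/-- Sequences which are eventually equal are forward asymptotic. -/
lemma tendsto_seqDist_forward {ν : ℝ} (hν : 0 < ν) (hν1 : ν < 1) {ξ ζ : Seq d} {N : ℕ}
    (h : ∀ j : ℤ, N ≤ j → ξ j = ζ j) :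
    Tendsto (fun n : ℕ => seqDist ν (shiftBy n ξ) (shiftBy n ζ)) atTop (𝓝 0) := by
  refine squeeze_zero (fun _ => seqDist_nonneg hν _ _)
    (fun n => seqDist_le (m := n - N) hν hν1 fun j hj => h _ (by omega)) ?_
  exact (tendsto_pow_atTop_nhds_zero_of_lt_one hν.le hν1).comp (tendsto_sub_atTop_nat N)

lemma tendsto_seqDist_backward {ν : ℝ} (hν : 0 < ν) (hν1 : ν < 1) {ξ ζ : Seq d} {N : ℕ}
    (h : ∀ j : ℤ, j < -N → ξ j = ζ j) :
    Tendsto (fun n : ℕ => seqDist ν (shiftBy (-n) ξ) (shiftBy (-n) ζ)) atTop (𝓝 0) := by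
  refine squeeze_zero (fun _ => seqDist_nonneg hν _ _)
    (fun n => seqDist_le (m := n - N) hν hν1 fun j hj => h _ (by omega)) ?_
  exact (tendsto_pow_atTop_nhds_zero_of_lt_one hν.le hν1).comp (tendsto_sub_atTop_nat N)

lemma tendsto_seq_iff {ι : Type*} {l : Filter ι} {u : ι → Seq d} {ξ : Seq d} :
    Tendsto u l (𝓝 ξ) ↔ ∀ j, ∀ᶠ i in l, u i j = ξ j := by
  rw [tendsto_pi_nhds]
  simp [nhds_discrete]

end ShiftBy

namespace SkewProduct

/-! ### Orbits in the fibres -/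

section Orbits

variable {d : ℕ} {M : Type*} [TopologicalSpace M] (Ψ : SkewProduct d M)

/-- The fibre component of the forward orbit of `(ξ, x)`. -/
def fwd (ξ : Seq d) : ℕ → M → M := seqIter fun j => Ψ.fiber (shiftBy j ξ)

/-- The fibre component of the backward orbit of `(ξ, x)`. -/
def bwd (ξ : Seq d) : ℕ → M → M := seqIter fun j => (Ψ.fiber (shiftBy (-(j + 1 : ℤ)) ξ)).symm

lemma map_pow (n : ℕ) (ξ : Seq d) (x : M) :
    (Ψ.map ^ n) (ξ, x) = (shiftBy n ξ, Ψ.fwd ξ n x) := by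
  induction n with
  | zero => simp [fwd]
  | succ n ih =>
    rw [pow_succ', Equiv.Perm.mul_apply, ih]
    refine Prod.ext ?_ rfl
    funext i
    simp only [map, shift, Equiv.coe_fn_mk, shiftBy_apply]
    congr 1; push_cast; ring

lemma map_symm_pow (n : ℕ) (ξ : Seq d) (x : M) :
    (Ψ.map.symm ^ n) (ξ, x) = (shiftBy (-n) ξ, Ψ.bwd ξ n x) := by
  induction n with
  | zero => simp [bwd]
  | succ n ih =>
    rw [pow_succ', Equiv.Perm.mul_apply, ih]
    have h : (shift d).symm (shiftBy (-n) ξ) = shiftBy (-(n + 1 : ℤ)) ξ := by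
      funext i
      simp only [shift, Equiv.coe_fn_symm_mk, shiftBy_apply]
      congr 1; ring
    refine Prod.ext ?_ ?_
    · simp only [map, Equiv.coe_fn_symm_mk, h]; push_cast; rfl
    · simp only [map, Equiv.coe_fn_symm_mk, h]; rfl

lemma fwd_bwd (n : ℕ) (ξ : Seq d) (x : M) : Ψ.fwd (shiftBy (-n) ξ) n (Ψ.bwd ξ n x) = x := by
  have h := Ψ.map_pow n (shiftBy (-n) ξ) (Ψ.bwd ξ n x)
  rw [← map_symm_pow, show Ψ.map.symm = Ψ.map⁻¹ from rfl, inv_pow, ← Equiv.Perm.mul_apply,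
    mul_inv_cancel, Equiv.Perm.one_apply] at h
  exact (congrArg Prod.snd h).symm

lemma map_symm_pow_map_pow (n m : ℕ) (z : Seq d × M) :
    (Ψ.map.symm ^ (m + n)) ((Ψ.map ^ n) z) = (Ψ.map.symm ^ m) z := by
  rw [show Ψ.map.symm = Ψ.map⁻¹ from rfl, pow_add, Equiv.Perm.mul_apply, inv_pow Ψ.map n,
    ← Equiv.Perm.mul_apply (Ψ.map ^ n)⁻¹, inv_mul_cancel, Equiv.Perm.one_apply]

lemma fwd_add (m n : ℕ) (ξ : Seq d) (x : M) :
    Ψ.fwd ξ (m + n) x = Ψ.fwd (shiftBy m ξ) n (Ψ.fwd ξ m x) := by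
  simp only [fwd, seqIter_add, shiftBy_shiftBy, Nat.cast_add]

lemma bwd_add (m n : ℕ) (ξ : Seq d) (x : M) :
    Ψ.bwd ξ (m + n) x = Ψ.bwd (shiftBy (-m) ξ) n (Ψ.bwd ξ m x) := by
  simp only [bwd, seqIter_add, shiftBy_shiftBy, Nat.cast_add]
  congr! 6; ring

lemma isOpenMap_fwd (ξ : Seq d) (n : ℕ) : IsOpenMap (Ψ.fwd ξ n) := by
  induction n with
  | zero => exact IsOpenMap.id
  | succ n ih => exact (Homeomorph.isOpenMap _).comp ih

lemma isOpenMap_bwd (ξ : Seq d) (n : ℕ) : IsOpenMap (Ψ.bwd ξ n) := by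
  induction n with
  | zero => exact IsOpenMap.id
  | succ n ih => exact (Homeomorph.isOpenMap _).comp ih

lemma continuous_map : Continuous Ψ.map :=
  (continuous_pi fun i => (continuous_apply (i + 1)).comp continuous_fst).prodMk Ψ.continuous_fiber

lemma continuous_map_pow (n : ℕ) : Continuous fun z => (Ψ.map ^ n) z := by
  induction n with
  | zero => exact continuous_id
  | succ n ih => simp only [pow_succ', Equiv.Perm.mul_apply]; exact Ψ.continuous_map.comp ih

end Orbits

/-! ### Density of stable and unstable sets, and mixing -/

/-- Uniform bounds for a partially hyperbolic symbolic skew-product. -/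
structure IsDominated {d : ℕ} {M : Type*} [MetricSpace M] (ν α lam bet C : ℝ)
    (Ψ : SkewProduct d M) : Prop where
  pos : 0 < ν
  lt_one : ν < 1
  expo_pos : 0 < α
  rpow_lt : ν ^ α < lam
  rpow_lt_inv : ν ^ α < bet⁻¹
  bet_pos : 0 < bet
  lower : ∀ ξ x y, lam * dist x y ≤ dist (Ψ.fiber ξ x) (Ψ.fiber ξ y)
  upper : ∀ ξ x y, dist (Ψ.fiber ξ x) (Ψ.fiber ξ y) ≤ bet * dist x y
  holder : IsLocHolderWith ν α univ Ψ C

/-- Symbols `S` whose fibre maps contract `K` and cover `B`, robustly at scale `ρ`. -/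
structure IsContractingCover {d : ℕ} {M : Type*} [MetricSpace M] (Ψ : SkewProduct d M)
    (S : Set (Fin d)) (K B : Set M) (θ ρ : ℝ) : Prop where
  nonneg : 0 ≤ θ
  lt_one : θ < 1
  subset : B ⊆ K
  mapsTo : ∀ ξ : Seq d, ξ 0 ∈ S → MapsTo (Ψ.fiber ξ) K K
  dist_le : ∀ ξ : Seq d, ξ 0 ∈ S → ∀ x ∈ K, ∀ y ∈ K,
    dist (Ψ.fiber ξ x) (Ψ.fiber ξ y) ≤ θ * dist x y
  cover : ∀ y ∈ B, ∃ i ∈ S, ∀ ξ : Seq d, ξ 0 = i → ∀ z, dist z y < ρ → ∃ w ∈ B, Ψ.fiber ξ w = z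

namespace IsDominated

variable {d : ℕ} {M : Type*} [MetricSpace M] {ν α lam bet C : ℝ} {Ψ : SkewProduct d M}

lemma rpow_pos (h : IsDominated ν α lam bet C Ψ) : 0 < ν ^ α := Real.rpow_pos_of_pos h.pos α

lemma rpow_lt_one (h : IsDominated ν α lam bet C Ψ) : ν ^ α < 1 :=
  Real.rpow_lt_one h.pos.le h.lt_one h.expo_pos

lemma lam_pos (h : IsDominated ν α lam bet C Ψ) : 0 < lam := h.rpow_pos.trans h.rpow_lt

lemma dist_fiber_le (h : IsDominated ν α lam bet C Ψ) {ξ ζ : Seq d}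
    (hξ : ∀ j : ℤ, 0 ≤ j → ξ j = ζ j) (n : ℕ) (x : M) :
    dist (Ψ.fiber (shiftBy n ξ) x) (Ψ.fiber (shiftBy n ζ) x) ≤ C * (ν ^ α) ^ n :=
  ((h.holder.2 _ _ (hξ (0 + n) (by simp)) x (by simp)).1).trans
    (mul_le_mul_of_nonneg_left (seqDist_rpow_le (ξ := shiftBy n ξ) (ζ := shiftBy n ζ) h.pos
      h.lt_one h.expo_pos fun j hj => hξ (j + n) (by omega)) h.holder.1)

lemma dist_fiber_symm_le (h : IsDominated ν α lam bet C Ψ) {ξ ζ : Seq d}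
    (hξ : ∀ j : ℤ, j < 0 → ξ j = ζ j) (n : ℕ) (x : M) :
    dist ((Ψ.fiber (shiftBy (-(n + 1 : ℤ)) ξ)).symm x)
      ((Ψ.fiber (shiftBy (-(n + 1 : ℤ)) ζ)).symm x) ≤ C * (ν ^ α) ^ n :=
  ((h.holder.2 _ _ (hξ (0 + -(n + 1 : ℤ)) (by omega)) x (by simp)).2).trans
    (mul_le_mul_of_nonneg_left (seqDist_rpow_le h.pos h.lt_one h.expo_pos
      fun j hj => hξ (j + -(n + 1 : ℤ)) (by omega)) h.holder.1)

lemma lower_symm (h : IsDominated ν α lam bet C Ψ) (ξ : Seq d) (x y : M) :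
    bet⁻¹ * dist x y ≤ dist ((Ψ.fiber ξ).symm x) ((Ψ.fiber ξ).symm y) := by
  rw [inv_mul_le_iff₀ h.bet_pos]
  simpa using h.upper ξ ((Ψ.fiber ξ).symm x) ((Ψ.fiber ξ).symm y)

lemma upper_symm (h : IsDominated ν α lam bet C Ψ) (ξ : Seq d) (x y : M) :
    dist ((Ψ.fiber ξ).symm x) ((Ψ.fiber ξ).symm y) ≤ lam⁻¹ * dist x y := by
  rw [le_inv_mul_iff₀ h.lam_pos]
  simpa using h.lower ξ ((Ψ.fiber ξ).symm x) ((Ψ.fiber ξ).symm y)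

/-- Displacement between points with the same image along sequences with the same future. -/
lemma dist_le_of_fwd_eq (h : IsDominated ν α lam bet C Ψ) {ξ ζ : Seq d}
    (hξ : ∀ j : ℤ, 0 ≤ j → ξ j = ζ j) {n : ℕ} {x y : M} (hxy : Ψ.fwd ξ n x = Ψ.fwd ζ n y) :
    dist x y ≤ C / (lam - ν ^ α) := by
  simpa using dist_seqIter_le_of_eq h.rpow_lt h.rpow_pos h.holder.1 (fun n => h.lower _)
    (h.dist_fiber_le hξ) hxy (Nat.zero_le n)

/-! ### Transfer of density from the fibre over a constant sequence to other fibres -/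

variable [CompactSpace M]

/-- After `N` shifts the sequence agrees with `s^∞` at all nonnegative places, so the fibre maps
along both approach each other at rate `ν ^ α < lam` and `dense_tendsto_seqIter` applies. The first
`N` maps compose to an open map, under which preimages of dense sets are dense. -/
lemma dense_tendsto_fwd (h : IsDominated ν α lam bet C Ψ) {s : Fin d} {a : M}
    (hd : Dense {x | Tendsto (fun n : ℕ => (Ψ.fiber fun _ => s)^[n] x) atTop (𝓝 a)})
    {ζ : Seq d} {N : ℕ} (hζ : ∀ j : ℤ, N ≤ j → ζ j = s) :
    Dense {x | Tendsto (fun n => Ψ.fwd ζ n x) atTop (𝓝 a)} := by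
  have h1 : Dense {x | Tendsto (fun n => Ψ.fwd (shiftBy N ζ) n x) atTop (𝓝 a)} := by
    refine dense_tendsto_seqIter (f := fun n => Ψ.fiber (shiftBy n fun _ => s)) h.rpow_lt
      h.rpow_pos h.rpow_lt_one h.holder.1 (fun n => h.lower _) (fun n => h.lower _) h.bet_pos.le
      (fun n => h.upper _) (h.dist_fiber_le fun j hj => (hζ (j + N) (by omega)).symm)
      (fun n => (Ψ.fiber _).continuous) (fun n => (Ψ.fiber _).surjective)
      (fun n => (Ψ.fiber _).continuous) (fun n => (Ψ.fiber _).surjective) ?_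
    simpa only [shiftBy_const, seqIter_const] using hd
  refine (h1.preimage (Ψ.isOpenMap_fwd ζ N)).mono fun x hx => ?_
  refine (tendsto_add_atTop_iff_nat N).1 ?_
  simpa only [add_comm _ N, fwd_add, mem_preimage, mem_ofPred_eq] using hx

/-- The same argument for the inverse fibre maps, whose least expansion is `bet⁻¹`; the relevant
domination is `ν ^ α < bet⁻¹`. -/
lemma dense_tendsto_bwd (h : IsDominated ν α lam bet C Ψ) {s : Fin d} {a : M}
    (hd : Dense {x | Tendsto (fun n : ℕ => (Ψ.fiber fun _ => s).symm^[n] x) atTop (𝓝 a)})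
    {ζ : Seq d} {N : ℕ} (hζ : ∀ j : ℤ, j < -N → ζ j = s) :
    Dense {x | Tendsto (fun n => Ψ.bwd ζ n x) atTop (𝓝 a)} := by
  have h1 : Dense {x | Tendsto (fun n => Ψ.bwd (shiftBy (-N) ζ) n x) atTop (𝓝 a)} := by
    refine dense_tendsto_seqIter
      (f := fun n : ℕ => (Ψ.fiber (shiftBy (-(n + 1 : ℤ)) fun _ => s)).symm) h.rpow_lt_inv
      h.rpow_pos h.rpow_lt_one h.holder.1 (fun n => h.lower_symm _) (fun n => h.lower_symm _)
      (inv_nonneg.2 h.lam_pos.le)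
      (fun n => h.upper_symm _) (h.dist_fiber_symm_le fun j hj => (hζ (j + -N) (by omega)).symm)
      (fun n => (Ψ.fiber _).symm.continuous) (fun n => (Ψ.fiber _).symm.surjective)
      (fun n => (Ψ.fiber _).symm.continuous) (fun n => (Ψ.fiber _).symm.surjective) ?_
    simpa only [shiftBy_const, seqIter_const] using hd
  refine (h1.preimage (Ψ.isOpenMap_bwd ζ N)).mono fun x hx => ?_
  refine (tendsto_add_atTop_iff_nat N).1 ?_
  simpa only [add_comm _ N, bwd_add, mem_preimage, mem_ofPred_eq] using hx

/-- Every nonempty open set contains a point whose forward orbit tends to `(s^∞, a)`. -/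
lemma exists_mem_tendsto_fwd (h : IsDominated ν α lam bet C Ψ) {s : Fin d} {a : M}
    (hd : Dense {x | Tendsto (fun n : ℕ => (Ψ.fiber fun _ => s)^[n] x) atTop (𝓝 a)})
    {U : Set (Seq d × M)} (hU : IsOpen U) (hne : U.Nonempty) :
    ∃ (ξ : Seq d) (x : M) (N : ℕ), (ξ, x) ∈ U ∧ (∀ j : ℤ, N ≤ j → ξ j = s) ∧
      Tendsto (fun n => Ψ.fwd ξ n x) atTop (𝓝 a) := by
  obtain ⟨⟨ξ, x⟩, hx⟩ := hne
  let ζ : ℕ → Seq d := fun N j => if (N : ℤ) ≤ j then s else ξ j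
  have hζ : Tendsto (fun N => (ζ N, x)) atTop (𝓝 (ξ, x)) := by
    refine Tendsto.prodMk_nhds (tendsto_seq_iff.2 fun j => ?_) tendsto_const_nhds
    filter_upwards [eventually_gt_atTop j.natAbs] with N hN
    exact if_neg (by omega)
  obtain ⟨N, hN⟩ := (hζ.eventually_mem (hU.mem_nhds hx)).exists
  have hζN : ∀ j : ℤ, N ≤ j → ζ N j = s := fun j hj => if_pos hj
  obtain ⟨y, hyU, hy⟩ := (h.dense_tendsto_fwd hd hζN).exists_mem_open
    (hU.preimage (Continuous.prodMk_right (ζ N))) ⟨x, hN⟩ |>.imp fun _ h => h.symm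
  exact ⟨ζ N, y, N, hyU, hζN, hy⟩

lemma dense_stableSet (h : IsDominated ν α lam bet C Ψ) {s : Fin d} {a : M}
    (ha : Ψ.fiber (fun _ => s) a = a)
    (hd : Dense {x | Tendsto (fun n : ℕ => (Ψ.fiber fun _ => s)^[n] x) atTop (𝓝 a)}) :
    Dense (Ψ.stableSet ν ((fun _ => s), a)) := by
  refine dense_iff_inter_open.2 fun U hU hne => ?_
  obtain ⟨ξ, x, N, hU, hξ, hx⟩ := h.exists_mem_tendsto_fwd hd hU hne
  refine ⟨(ξ, x), hU, ?_⟩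
  have hfix : ∀ n, Ψ.fwd (fun _ => s) n a = a := fun n => by
    simp only [fwd, shiftBy_const, seqIter_const]
    exact Function.iterate_fixed ha n
  simp only [stableSet, pairDist, map_pow, hfix, mem_ofPred_eq]
  simpa using (tendsto_seqDist_forward (ζ := fun _ => s) h.pos h.lt_one hξ).max
    (tendsto_iff_dist_tendsto_zero.1 hx)

/-! ### Contracting covers: pulling back within `B` -/

omit [CompactSpace M] in
lemma mapsTo_fwd {S : Set (Fin d)} {K B : Set M} {θ ρ : ℝ}
    (hc : Ψ.IsContractingCover S K B θ ρ) {ξ : Seq d} {m : ℕ}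
    (hξ : ∀ j : ℤ, 0 ≤ j → j < m → ξ j ∈ S) : MapsTo (Ψ.fwd ξ m) K K := by
  induction m with
  | zero => exact fun x hx => hx
  | succ m ih =>
    exact (hc.mapsTo (shiftBy m ξ) (hξ (0 + m) (by omega) (by push_cast; omega))).comp
      (ih fun j h0 hj => hξ j h0 (by push_cast; omega))

omit [CompactSpace M] in
lemma dist_fwd_le {S : Set (Fin d)} {K B : Set M} {θ ρ : ℝ}
    (hc : Ψ.IsContractingCover S K B θ ρ) {ξ : Seq d} {m : ℕ}
    (hξ : ∀ j : ℤ, 0 ≤ j → j < m → ξ j ∈ S) {x y : M} (hx : x ∈ K) (hy : y ∈ K) :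
    dist (Ψ.fwd ξ m x) (Ψ.fwd ξ m y) ≤ θ ^ m * dist x y := by
  induction m with
  | zero => simp [fwd]
  | succ m ih =>
    have hξ' : ∀ j : ℤ, 0 ≤ j → j < m → ξ j ∈ S := fun j h0 hj => hξ j h0 (by push_cast; omega)
    calc dist (Ψ.fwd ξ (m + 1) x) (Ψ.fwd ξ (m + 1) y)
        ≤ θ * dist (Ψ.fwd ξ m x) (Ψ.fwd ξ m y) :=
          hc.dist_le (shiftBy m ξ) (hξ (0 + m) (by omega) (by push_cast; omega)) _
            (mapsTo_fwd hc hξ' hx) _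
            (mapsTo_fwd hc hξ' hy)
      _ ≤ θ * (θ ^ m * dist x y) := by gcongr; exacts [hc.nonneg, ih hξ']
      _ = θ ^ (m + 1) * dist x y := by ring

omit [CompactSpace M] in
/-- Backward orbits can be continued in `B` along symbols in `S`, with a prescribed remote past. -/
lemma exists_fwd_eq (h : IsDominated ν α lam bet C Ψ) {S : Set (Fin d)} {K B : Set M} {θ ρ : ℝ}
    (hc : Ψ.IsContractingCover S K B θ ρ) (hρ : C / (lam - ν ^ α) < ρ) {s : Fin d} {σ : Seq d}
    (hσ : ∀ j : ℤ, j < 0 → σ j = s) {y : M} (hy : y ∈ B) (n m : ℕ) :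
    ∃ (ζ : Seq d) (w : M), w ∈ B ∧ (∀ j : ℤ, j < 0 → ζ j = s) ∧
      (∀ j : ℤ, 0 ≤ j → j < m → ζ j ∈ S) ∧ (∀ j : ℤ, 0 ≤ j → ζ (j + m) = σ j) ∧
      Ψ.fwd ζ (m + n) w = Ψ.fwd σ n y := by
  induction m with
  | zero => exact ⟨σ, y, hy, hσ, fun j h0 hj => by simp at hj; omega, fun j _ => by simp, by simp⟩
  | succ m ih =>
    obtain ⟨ζ, w, hw, hpast, hS, hfut, heq⟩ := ih
    -- The symbol `i` depends on `w` alone. This matters because the point `w₁` to be lifted is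
    -- known only after `ζ'`, hence `i`, has been fixed.
    obtain ⟨i, hi, hcov⟩ := hc.cover w hw
    let ζ' : Seq d := fun j => if j < 0 then s else if j = 0 then i else ζ (j - 1)
    have hζ' : ∀ j : ℤ, 0 ≤ j → shiftBy (1 : ℕ) ζ' j = ζ j := fun j hj => by
      simp only [shiftBy_apply, ζ', Nat.cast_one]
      rw [if_neg (by omega), if_neg (by omega)]; simp
    -- Prepending `i` and resetting the past alters every later fibre map, so `w` is replaced by the
    -- point `w₁` that still reaches the same target. Its distance to `w` is below `ρ` independently
    -- of `m`: the errors do not accumulate over the induction.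
    obtain ⟨w₁, hw₁⟩ := seqIter_surjective (f := fun j => Ψ.fiber (shiftBy j (shiftBy (1 : ℕ) ζ')))
      (fun j => (Ψ.fiber _).surjective) (m + n) (Ψ.fwd σ n y)
    obtain ⟨w', hw', hww'⟩ := hcov ζ' (by simp [ζ']) w₁
      ((h.dist_le_of_fwd_eq hζ' (hw₁.trans heq.symm)).trans_lt hρ)
    refine ⟨ζ', w', hw', fun j hj => if_pos hj, fun j h0 hj => ?_, fun j hj => ?_, ?_⟩
    · rcases h0.eq_or_lt with rfl | h0
      · simpa [ζ'] using hi
      · simp only [ζ']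
        rw [if_neg (by omega), if_neg (by omega)]
        exact hS _ (by omega) (by push_cast at hj; omega)
    · rw [← hfut j hj]
      simp only [ζ']
      rw [if_neg (by omega), if_neg (by omega)]
      congr 1; push_cast; ring
    · rw [show m + 1 + n = 1 + (m + n) by ring, fwd_add, ← hw₁, ← hww']
      simp [fwd, seqIter_succ]

/-- Every nonempty open set contains the image of a whole fibre `{ζ} × K` under an iterate, where
the past of `ζ` is constant. -/
lemma exists_forall_map_pow_mem (h : IsDominated ν α lam bet C Ψ) {S : Set (Fin d)} {K B : Set M}
    {θ ρ : ℝ} (hc : Ψ.IsContractingCover S K B θ ρ) (hρ : C / (lam - ν ^ α) < ρ) (s : Fin d)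
    {t : Fin d} {q : M} (hq : Metric.ball q ρ ⊆ B)
    (hd : Dense {x | Tendsto (fun n : ℕ => (Ψ.fiber fun _ => t).symm^[n] x) atTop (𝓝 q)})
    {V : Set (Seq d × M)} (hV : IsOpen V) (hne : V.Nonempty) :
    ∃ (ζ : Seq d) (L : ℕ), (∀ j : ℤ, j < 0 → ζ j = s) ∧ ∀ u ∈ K, (Ψ.map ^ L) (ζ, u) ∈ V := by
  obtain ⟨⟨ξ, x⟩, hx⟩ := hne
  obtain ⟨N, r, hr, hsub⟩ :
      ∃ (N : ℕ) (r : ℝ), 0 < r ∧ ∀ η y, (∀ j : ℤ, -N ≤ j → η j = ξ j) → dist y x < r →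
        (η, y) ∈ V := by
    obtain ⟨A, hA, r, hr, hAr⟩ : ∃ A ∈ 𝓝 ξ, ∃ r > 0, A ×ˢ Metric.ball x r ⊆ V := by
      obtain ⟨A, hA, A', hA', hsub⟩ := mem_nhds_prod_iff.1 (hV.mem_nhds hx)
      obtain ⟨r, hr, hr'⟩ := Metric.mem_nhds_iff.1 hA'
      exact ⟨A, hA, r, hr, (prod_mono subset_rfl hr').trans hsub⟩
    rw [nhds_pi, Filter.mem_pi] at hA
    obtain ⟨I, hI, t, ht, htA⟩ := hA
    obtain ⟨N, hN⟩ : ∃ N : ℕ, ∀ j ∈ I, j.natAbs ≤ N :=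
      (hI.image Int.natAbs).bddAbove.imp fun N hN j hj => hN ⟨j, hj, rfl⟩
    refine ⟨N, r, hr, fun η y hη hy => hAr ⟨htA fun j hj => ?_, hy⟩⟩
    change η j ∈ t j
    rw [hη j (by have := hN j hj; omega)]
    exact mem_of_mem_nhds (ht j)
  set R := C / (lam - ν ^ α) with hR
  -- The remote past is made of `t`, so that backward orbits over `ξ'` tend to `q` from a dense set
  -- of points.
  let ξ' : Seq d := fun j => if j < -N then t else ξ j
  obtain ⟨y, hy, hyx⟩ := Metric.dense_iff.1
    (h.dense_tendsto_bwd hd (ζ := ξ') (N := N) fun j hj => if_pos hj) x (r / 2) (half_pos hr)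
    |>.imp fun _ h => h.symm
  -- The radius `ρ - R` leaves room for the displacement `R` caused by exchanging the past `t` for
  -- `s`. The bound `N ≤ n` ensures that this exchange does not touch the coordinates from `-N` on,
  -- seen from time `n`.
  obtain ⟨n, hnq, hnN⟩ := ((hy.eventually_mem
    (Metric.ball_mem_nhds q (sub_pos.2 hρ))).and (eventually_ge_atTop N)).exists
  let σ : Seq d := fun j => if j < 0 then s else shiftBy (-n) ξ' j
  have hσ : ∀ j : ℤ, 0 ≤ j → σ j = shiftBy (-n) ξ' j := fun j hj => if_neg (by omega)
  obtain ⟨y₀, hy₀⟩ := seqIter_surjective (f := fun j => Ψ.fiber (shiftBy j σ))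
      (fun j => (Ψ.fiber _).surjective) n y
  have hyy : dist y₀ (Ψ.bwd ξ' n y) ≤ R :=
    h.dist_le_of_fwd_eq hσ (hy₀.trans (Ψ.fwd_bwd n ξ' y).symm)
  have hy₀B : y₀ ∈ B := hq <| by
    have := dist_triangle y₀ (Ψ.bwd ξ' n y) q
    rw [Metric.mem_ball] at hnq ⊢
    linarith
  -- The number `m` of contracting steps is chosen after `n`, so as to beat the possible expansion
  -- `bet ^ n` of the last `n` steps on all of `K`.
  obtain ⟨m, hm⟩ : ∃ m : ℕ, bet ^ n * (θ ^ m * Metric.diam (univ : Set M)) < r / 2 := by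
    have hlim : Tendsto (fun m : ℕ => bet ^ n * (θ ^ m * Metric.diam (univ : Set M))) atTop
        (𝓝 0) := by
      simpa using ((tendsto_pow_atTop_nhds_zero_of_lt_one hc.nonneg hc.lt_one).mul_const
        (Metric.diam (univ : Set M))).const_mul (bet ^ n)
    exact (hlim.eventually_lt_const (half_pos hr)).exists
  obtain ⟨ζ, w, hw, hpast, hS, hfut, heq⟩ :=
    h.exists_fwd_eq hc hρ (s := s) (σ := σ) (fun j hj => if_pos hj) hy₀B n m
  refine ⟨ζ, m + n, hpast, fun u hu => ?_⟩
  rw [map_pow]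
  refine hsub _ _ (fun j hj => ?_) ?_
  · have h1 : ζ (j + (m + n : ℕ)) = σ (j + n) := by
      rw [← hfut (j + n) (by omega)]; congr 1; push_cast; ring
    rw [shiftBy_apply, h1, hσ _ (by omega)]
    simp only [shiftBy_apply, add_neg_cancel_right, ξ']
    exact if_neg (by omega)
  · have h1 : dist (Ψ.fwd ζ (m + n) u) y ≤ bet ^ n * (θ ^ m * Metric.diam (univ : Set M)) := by
      rw [← show Ψ.fwd ζ (m + n) w = y from heq.trans hy₀, fwd_add, fwd_add]
      refine (dist_seqIter_le h.bet_pos.le (fun n => h.upper _) n _ _).trans ?_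
      refine mul_le_mul_of_nonneg_left ((dist_fwd_le hc hS hu (hc.subset hw)).trans ?_)
        (pow_nonneg h.bet_pos.le n)
      exact mul_le_mul_of_nonneg_left (Metric.dist_le_diam_of_mem isCompact_univ.isBounded
        (mem_univ _) (mem_univ _)) (pow_nonneg hc.nonneg m)
    have h2 := dist_triangle (Ψ.fwd ζ (m + n) u) y x
    rw [Metric.mem_ball] at hyx
    linarith

/-- The sequence `ζ` has the past of `s^∞`, so the backward orbit of `a` over `s^∞` is shadowed at
an exponential rate by some `b` over `ζ`. The displacement bound puts `b` in `K`; hence `(ζ, b)`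
lies in the unstable set and is sent into `V` together with the whole of `{ζ} × K`. -/
lemma dense_unstableSet (h : IsDominated ν α lam bet C Ψ) {S : Set (Fin d)} {K B : Set M}
    {θ ρ : ℝ} (hc : Ψ.IsContractingCover S K B θ ρ) (hρ : C / (lam - ν ^ α) < ρ) {s t : Fin d}
    {a q : M} (ha : Ψ.fiber (fun _ => s) a = a)
    (haK : Metric.closedBall a (C / (bet⁻¹ - ν ^ α)) ⊆ K) (hq : Metric.ball q ρ ⊆ B)
    (hd : Dense {x | Tendsto (fun n : ℕ => (Ψ.fiber fun _ => t).symm^[n] x) atTop (𝓝 q)}) :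
    Dense (Ψ.unstableSet ν ((fun _ => s), a)) := by
  refine dense_iff_inter_open.2 fun V hV hne => ?_
  obtain ⟨ζ, L, hζ, hL⟩ := h.exists_forall_map_pow_mem hc hρ s hq hd hV hne
  have hfix : ∀ n, Ψ.bwd (fun _ => s) n a = a := fun n => by
    simp only [bwd, shiftBy_const, seqIter_const]
    exact Function.iterate_fixed ((Homeomorph.symm_apply_eq _).2 ha.symm) n
  obtain ⟨b, hb⟩ := exists_shadow
    (f := fun n : ℕ => (Ψ.fiber (shiftBy (-(n + 1 : ℤ)) fun _ => s)).symm)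
    (g := fun n : ℕ => (Ψ.fiber (shiftBy (-(n + 1 : ℤ)) ζ)).symm) h.rpow_lt_inv
    h.rpow_pos h.holder.1 (fun n => h.lower_symm _)
    (h.dist_fiber_symm_le fun j hj => (hζ _ (by omega)).symm)
    (fun n => (Ψ.fiber _).symm.continuous) (fun n => (Ψ.fiber _).symm.surjective) a
  change ∀ n, dist (Ψ.bwd (fun _ => s) n a) (Ψ.bwd ζ n b) ≤ _ at hb
  simp only [hfix] at hb
  have hbK : b ∈ K := haK (by simpa [dist_comm, bwd] using hb 0)
  refine ⟨(Ψ.map ^ L) (ζ, b), hL b hbK, ?_⟩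
  refine (tendsto_add_atTop_iff_nat L).1 ?_
  have h0 : Tendsto (fun n : ℕ => C / (bet⁻¹ - ν ^ α) * (ν ^ α) ^ n) atTop (𝓝 0) := by
    simpa using (tendsto_pow_atTop_nhds_zero_of_lt_one h.rpow_pos.le h.rpow_lt_one).const_mul _
  simp only [map_symm_pow_map_pow, pairDist, map_symm_pow, hfix]
  simpa [dist_comm, shiftBy_const] using (tendsto_seqDist_backward (ξ := ζ) (ζ := fun _ => s)
    (N := 0) h.pos
    h.lt_one fun j hj => hζ j (by simpa using hj)).max (squeeze_zero (fun _ => dist_nonneg) hb h0)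

/-- The future of `ξ` and the past of `ζ` are both made of `s`, so they can be glued with a waiting
time of any large length; during it the orbit remains in `K`. As every large length is allowed, this
gives mixing and not only transitivity. -/
lemma topMixing (h : IsDominated ν α lam bet C Ψ) {S : Set (Fin d)} {K B : Set M}
    {θ ρ : ℝ} (hc : Ψ.IsContractingCover S K B θ ρ) (hρ : C / (lam - ν ^ α) < ρ)
    (hK : IsCompact K) {s t : Fin d} (hs : s ∈ S) {a q : M} (haK : K ∈ 𝓝 a)
    (hda : Dense {x | Tendsto (fun n : ℕ => (Ψ.fiber fun _ => s)^[n] x) atTop (𝓝 a)})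
    (hq : Metric.ball q ρ ⊆ B)
    (hdq : Dense {x | Tendsto (fun n : ℕ => (Ψ.fiber fun _ => t).symm^[n] x) atTop (𝓝 q)}) :
    Ψ.TopMixing := by
  intro U V hU hV hUne hVne
  obtain ⟨ζ, L, hζ, hL⟩ := h.exists_forall_map_pow_mem hc hρ s hq hdq hV hVne
  obtain ⟨ξ, x, N₀, hξU, hξ, hx⟩ := h.exists_mem_tendsto_fwd hda hU hUne
  obtain ⟨N, hNK, hN₀⟩ := ((hx.eventually_mem (interior_mem_nhds.2 haK)).and
    (eventually_ge_atTop N₀)).exists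
  -- Tube lemma: the fibre point at the time of arrival is controlled only as a point of `K`, so the
  -- inclusion in `V` is needed uniformly on `K` and for base points near `ζ`.
  have htube : ∀ᶠ ζ' in 𝓝 ζ, ∀ u ∈ K, (Ψ.map ^ L) (ζ', u) ∈ V := by
    refine hK.eventually_forall_of_forall_eventually fun u hu => ?_
    exact (Ψ.continuous_map_pow L).continuousAt.eventually_mem (hV.mem_nhds (hL u hu))
  -- Follows `ξ` up to time `N`, then `s`, then `ζ` from time `m` on. The two rules agree where they
  -- overlap, so `η m` tends to `ξ` while its `m`-th shift tends to `ζ`.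
  let η : ℕ → Seq d := fun m j => if j < N then ξ j else ζ (j - m)
  have hη : Tendsto η atTop (𝓝 ξ) := by
    refine tendsto_seq_iff.2 fun j => ?_
    filter_upwards [eventually_gt_atTop j.natAbs] with m hm
    by_cases hj : j < N
    · exact if_pos hj
    · simp only [η, if_neg hj]
      rw [hζ _ (by omega), hξ _ (by omega)]
  have hη' : Tendsto (fun m : ℕ => shiftBy m (η m)) atTop (𝓝 ζ) := by
    refine tendsto_seq_iff.2 fun j => ?_
    filter_upwards [eventually_ge_atTop (j.natAbs + N)] with m hm
    simp only [η, shiftBy_apply]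
    rw [if_neg (by omega)]; simp
  have hηx : Tendsto (fun m => (η m, x)) atTop (𝓝 (ξ, x)) := hη.prodMk_nhds tendsto_const_nhds
  have hfN : Tendsto (fun m => Ψ.fwd (η m) N x) atTop (𝓝 (Ψ.fwd ξ N x)) := by
    have h1 := ((Ψ.continuous_map_pow N).snd.tendsto (ξ, x)).comp hηx
    simpa only [Function.comp_def, map_pow] using h1
  obtain ⟨m₀, hm₀⟩ := eventually_atTop.1 ((hηx.eventually_mem (hU.mem_nhds hξU)).and
    ((hfN.eventually_mem (isOpen_interior.mem_nhds hNK)).and (hη'.eventually htube)))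
  refine ⟨m₀ + N + L, fun n hn => ?_⟩
  obtain ⟨m, rfl⟩ : ∃ m, n = L + m := ⟨n - L, by omega⟩
  obtain ⟨hmU, hmK, hmV⟩ := hm₀ m (by omega)
  refine ⟨(Ψ.map ^ (L + m)) (η m, x), mem_image_of_mem _ hmU, ?_⟩
  rw [pow_add, Equiv.Perm.mul_apply, Ψ.map_pow m]
  refine hmV _ ?_
  obtain ⟨l, rfl⟩ : ∃ l, m = N + l := ⟨m - N, by omega⟩
  rw [fwd_add]
  refine mapsTo_fwd hc (fun j h0 hj => ?_) (interior_subset hmK)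
  simp only [shiftBy_apply, η]
  rw [if_neg (by omega), hζ _ (by push_cast; omega)]
  exact hs

end IsDominated

end SkewProduct

/-! ### Lipschitz estimates on Riemannian manifolds -/

section Riemannian

open Manifold MeasureTheory
open scoped ENNReal NNReal

variable {E : Type*} [NormedAddCommGroup E] [NormedSpace ℝ E] {H : Type*} [TopologicalSpace H]
  {I : ModelWithCorners ℝ E H} {M : Type*} [MetricSpace M] [ChartedSpace H M]
  [RiemannianBundle (fun x : M => TangentSpace I x)] [IsRiemannianManifold I M]

section General

variable {E' : Type*} [NormedAddCommGroup E'] [NormedSpace ℝ E'] {H' : Type*} [TopologicalSpace H']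
  {I' : ModelWithCorners ℝ E' H'} {N : Type*} [MetricSpace N] [ChartedSpace H' N]
  [RiemannianBundle (fun x : N => TangentSpace I' x)] [IsRiemannianManifold I' N]

/-- A map whose derivative is bounded by `c` on a ball is `c`-Lipschitz on a smaller ball. -/
lemma dist_le_of_enorm_mfderiv_le {h : M → N} {x₀ : M} {R : ℝ} {c : ℝ≥0}
    (hh : ∀ y ∈ Metric.ball x₀ (3 * R), MDifferentiableAt I I' h y)
    (hh1 : ContMDiffOn I I' 1 h (Metric.ball x₀ (3 * R)))
    (hb : ∀ y ∈ Metric.ball x₀ (3 * R), ∀ v : TangentSpace I y,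
      ‖(mfderiv I I' h y v : TangentSpace I' (h y))‖ₑ ≤ c * ‖v‖ₑ) {x y : M}
    (hx : x ∈ Metric.ball x₀ R) (hy : y ∈ Metric.ball x₀ R) :
    dist (h x) (h y) ≤ c * dist x y := by
  have key : ∀ l : ℝ≥0∞, edist x y < l → l ≤ ENNReal.ofReal (2 * R) →
      edist (h x) (h y) ≤ c * l := by
    intro l hl hlR
    rw [IsRiemannianManifold.out (I := I) x y] at hl
    obtain ⟨γ, h0, h1, hγ, hlen⟩ := exists_lt_of_riemannianEDist_lt hl
    -- A path from the ball of radius `R` with length below `2 * R` stays in the ball of radius `3 *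
    -- R`; this is why the derivative bound is required on the larger ball.
    have hball : MapsTo γ (Icc 0 1) (Metric.ball x₀ (3 * R)) := by
      intro t ht
      have h2 : edist x (γ t) ≤ pathELength I γ 0 t := by
        rw [IsRiemannianManifold.out (I := I)]
        exact riemannianEDist_le_pathELength (hγ.mono (Icc_subset_Icc_right ht.2)) h0 rfl ht.1
      have h3 : edist x (γ t) < ENNReal.ofReal (2 * R) :=
        (h2.trans (pathELength_mono le_rfl ht.2)).trans_lt (hlen.trans_le hlR)
      have h4 : dist x (γ t) < 2 * R := by
        rwa [edist_dist, ENNReal.ofReal_lt_ofReal_iff_of_nonneg dist_nonneg] at h3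
      have h5 := dist_triangle_left (γ t) x₀ x
      rw [Metric.mem_ball] at hx ⊢
      linarith
    have hsm : ContMDiffOn 𝓘(ℝ, ℝ) I' 1 (h ∘ γ) (Icc 0 1) := hh1.comp hγ hball
    rw [IsRiemannianManifold.out (I := I')]
    calc riemannianEDist I' (h x) (h y) ≤ pathELength I' (h ∘ γ) 0 1 :=
          riemannianEDist_le_pathELength hsm (by simp [h0]) (by simp [h1]) zero_le_one
      _ ≤ c * pathELength I γ 0 1 := by
        rw [pathELength_eq_lintegral_mfderiv_Ioo, pathELength_eq_lintegral_mfderiv_Ioo,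
          ← lintegral_const_mul' _ _ ENNReal.coe_ne_top]
        refine setLIntegral_mono' measurableSet_Ioo fun t ht => ?_
        have htI : t ∈ Icc (0 : ℝ) 1 := Ioo_subset_Icc_self ht
        have hd : MDifferentiableAt 𝓘(ℝ, ℝ) I γ t :=
          (hγ.mdifferentiableOn one_ne_zero t htI).mdifferentiableAt (Icc_mem_nhds ht.1 ht.2)
        rw [mfderiv_comp t (hh _ (hball htI)) hd]
        exact hb _ (hball htI) _
      _ ≤ c * l := by gcongr
  have hxy : dist x y < 2 * R := by
    have := dist_triangle_right x y x₀
    rw [Metric.mem_ball] at hx hy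
    linarith
  have h1 : ∀ l : ℝ, dist x y < l → l < 2 * R → dist (h x) (h y) ≤ c * l := by
    intro l hl hl'
    have hl0 : 0 < l := dist_nonneg.trans_lt hl
    have h2 := key (ENNReal.ofReal l) (by rwa [edist_dist, ENNReal.ofReal_lt_ofReal_iff hl0])
      (ENNReal.ofReal_le_ofReal hl'.le)
    rw [edist_dist, ← ENNReal.ofReal_coe_nnreal, ← ENNReal.ofReal_mul c.coe_nonneg,
      ENNReal.ofReal_le_ofReal_iff (by positivity)] at h2
    exact h2
  have hlim : Tendsto (fun l : ℝ => c * l) (𝓝[>] dist x y) (𝓝 (c * dist x y)) :=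
    ((continuous_const.mul continuous_id).tendsto _).mono_left nhdsWithin_le_nhds
  refine ge_of_tendsto hlim ?_
  filter_upwards [self_mem_nhdsWithin, nhdsWithin_le_nhds (Iio_mem_nhds hxy)] with l hl hl'
    using h1 l hl hl'

end General

-- The estimates below use only continuity of the metric; this provides it for the smooth metric of
-- the theorem.
omit [IsRiemannianManifold I M] in
lemma isContinuousRiemannianBundle_of_contMDiff {n : ℕ∞ω} [IsManifold I 1 M]
    [IsContMDiffRiemannianBundle I n E (fun x : M => TangentSpace I x)] :
    IsContinuousRiemannianBundle E (fun x : M => TangentSpace I x) := by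
  obtain ⟨g, hg, hg'⟩ := IsContMDiffRiemannianBundle.exists_contMDiff (IB := I) (n := n)
    (F := E) (E := fun x : M => TangentSpace I x)
  exact ⟨g, hg.continuous, hg'⟩

variable [IsManifold I 1 M] [IsContinuousRiemannianBundle E (fun x : M => TangentSpace I x)]

omit [IsRiemannianManifold I M] in
lemma continuous_norm_tangentBundle : Continuous fun V : TangentBundle I M => ‖V.2‖ := by
  have h : Continuous fun V : TangentBundle I M => inner ℝ V.2 V.2 :=
    Continuous.inner_bundle (F := E) (E := fun x : M => TangentSpace I x)
      (b := fun V : TangentBundle I M => V.1) continuous_id continuous_id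
  simp only [norm_eq_sqrt_real_inner]
  exact h.sqrt

omit [IsRiemannianManifold I M] in
/-- A strict bound for the derivative at a point persists nearby, also for nearby maps. -/
lemma eventually_norm_mfderiv_le [FiniteDimensional ℝ E] {P : Type*} [TopologicalSpace P]
    {G : P → M → M} {p₀ : P} {x₀ : M} {c c' : ℝ} (hc : c < c')
    (hG : ∀ v : TangentSpace I x₀, ContinuousAt
      (fun z : P × TangentBundle I M => tangentMap I I (G z.1) z.2) (p₀, ⟨x₀, v⟩))
    (hb : ∀ v : TangentSpace I x₀,
      ‖(mfderiv I I (G p₀) x₀ v : TangentSpace I (G p₀ x₀))‖ ≤ c * ‖v‖) :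
    ∀ᶠ z in 𝓝 (p₀, x₀), ∀ v : TangentSpace I z.2,
      ‖(mfderiv I I (G z.1) z.2 v : TangentSpace I (G z.1 z.2))‖ ≤ c' * ‖v‖ := by
  let e := trivializationAt E (fun x : M => TangentSpace I x) x₀
  have hx₀ : x₀ ∈ e.baseSet := FiberBundle.mem_baseSet_trivializationAt' x₀
  -- In the trivialization the tangent vectors become a fixed model space, whose unit sphere is
  -- compact. The strict inequality persists near each unit vector, hence near `(p₀, x₀)` uniformly
  -- in the direction, and homogeneity covers all vectors.
  have key : ∀ w ∈ Metric.sphere (0 : E) 1, ∀ᶠ z in 𝓝 ((p₀, x₀), w),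
      ‖(mfderiv I I (G z.1.1) z.1.2 (e.symm z.1.2 z.2) : TangentSpace I (G z.1.1 z.1.2))‖ ≤
        c' * ‖e.symm z.1.2 z.2‖ := by
    intro w hw
    have hs : ContinuousAt (fun z : (P × M) × E =>
        (⟨z.1.2, e.symm z.1.2 z.2⟩ : TangentBundle I M)) ((p₀, x₀), w) := by
      have h1 : ContinuousAt (fun z : M × E => (⟨z.1, e.symm z.1 z.2⟩ : TangentBundle I M))
          (x₀, w) := e.continuousOn_symm.continuousAt
        ((e.open_baseSet.prod isOpen_univ).mem_nhds ⟨hx₀, mem_univ _⟩)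
      exact ContinuousAt.comp (f := fun z : (P × M) × E => (z.1.2, z.2)) (x := ((p₀, x₀), w)) h1
        (by fun_prop)
    have h2 : ContinuousAt (fun z : (P × M) × E =>
        ‖(tangentMap I I (G z.1.1) ⟨z.1.2, e.symm z.1.2 z.2⟩).2‖) ((p₀, x₀), w) := by
      refine continuous_norm_tangentBundle.continuousAt.comp ?_
      exact ContinuousAt.comp (f := fun z : (P × M) × E =>
        (z.1.1, (⟨z.1.2, e.symm z.1.2 z.2⟩ : TangentBundle I M))) (hG (e.symm x₀ w))
        (ContinuousAt.prodMk (by fun_prop) hs)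
    have h3 : ContinuousAt (fun z : (P × M) × E => c' * ‖e.symm z.1.2 z.2‖) ((p₀, x₀), w) :=
      (ContinuousAt.comp (g := fun V : TangentBundle I M => ‖V.2‖)
        continuous_norm_tangentBundle.continuousAt hs).const_mul c'
    have hne : e.symm x₀ w ≠ 0 := by
      intro h0
      have h4 := (e.continuousLinearEquivAt ℝ x₀ hx₀).apply_symm_apply w
      rw [show (e.continuousLinearEquivAt ℝ x₀ hx₀).symm w = e.symm x₀ w from rfl, h0,
        map_zero] at h4
      simp [← h4] at hw
    have h5 := (h2.eventually_lt h3 (lt_of_le_of_lt (hb (e.symm x₀ w))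
      (mul_lt_mul_of_pos_right hc (norm_pos_iff.2 hne))))
    exact h5.mono fun z hz => hz.le
  have hcpt := (isCompact_sphere (0 : E) 1).eventually_forall_of_forall_eventually
    (P := fun (z : P × M) (w : E) =>
      ‖(mfderiv I I (G z.1) z.2 (e.symm z.2 w) : TangentSpace I (G z.1 z.2))‖ ≤
        c' * ‖e.symm z.2 w‖) key
  have hbase : ∀ᶠ z : P × M in 𝓝 (p₀, x₀), z.2 ∈ e.baseSet :=
    continuous_snd.continuousAt.eventually_mem (e.open_baseSet.mem_nhds hx₀)
  filter_upwards [hcpt, hbase] with z hz hzb v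
  let L := e.continuousLinearEquivAt ℝ z.2 hzb
  by_cases hv : v = 0
  · simp [hv]
  have hw : L v ≠ 0 := by simpa using hv
  have h1 := hz ((‖L v‖)⁻¹ • L v) (by simp [norm_smul, hw])
  have h2 : e.symm z.2 ((‖L v‖)⁻¹ • L v) = (‖L v‖)⁻¹ • v := by
    change L.symm ((‖L v‖)⁻¹ • L v) = _
    rw [map_smul, L.symm_apply_apply]
  rw [h2, map_smul, norm_smul, norm_smul, mul_left_comm] at h1
  exact le_of_mul_le_mul_left h1 (norm_pos_iff.2 (inv_ne_zero (norm_ne_zero_iff.2 hw)))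

lemma enorm_le_coe_mul_enorm {F G : Type*} [SeminormedAddGroup F] [SeminormedAddGroup G] {a : F}
    {b : G} {c : ℝ≥0} (h : ‖a‖ ≤ c * ‖b‖) : ‖a‖ₑ ≤ c * ‖b‖ₑ := by
  rw [enorm_eq_nnnorm, enorm_eq_nnnorm, ← ENNReal.coe_mul, ENNReal.coe_le_coe]
  exact h

omit [IsRiemannianManifold I M] in
/-- The chart at `x`, followed by the identification with the tangent space at `x`, has derivative
nearly bounded by `1`. -/
lemma eventually_norm_symm_mfderiv_extChartAt_le (x : M) {r : ℝ} (hr : 1 < r) :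
    ∀ᶠ y in 𝓝 x, ∀ v : TangentSpace I y,
      ‖(trivializationAt E (fun x : M => TangentSpace I x) x).symmL ℝ x
        (mfderiv I 𝓘(ℝ, E) (extChartAt I x) y v)‖ ≤ r * ‖v‖ := by
  filter_upwards [eventually_norm_symmL_trivializationAt_self_comp_lt E
    (fun x : M => TangentSpace I x) x hr, chart_source_mem_nhds H x] with y hy hys v
  have h1 := ContinuousLinearMap.le_of_opNorm_le _ hy.le v
  rw [TangentBundle.continuousLinearMapAt_trivializationAt hys] at h1
  exact h1

/-- Local test functions: for `w₀` tangent at `x`, there is a function with differential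
`⟪w₀, ·⟫` at `x` which is locally Lipschitz with constant nearly `‖w₀‖`. -/
lemma exists_lipschitz_testFunction [FiniteDimensional ℝ E] (x : M) (w₀ : TangentSpace I x) {r : ℝ}
    (hr : 1 < r) :
    ∃ (u : M → ℝ) (L : E →L[ℝ] ℝ), HasMFDerivAt I 𝓘(ℝ, ℝ) u x L ∧ L w₀ = ‖w₀‖ ^ 2 ∧
      ∀ᶠ y in 𝓝 x, |u y - u x| ≤ r * ‖w₀‖ * dist y x := by
  set e := trivializationAt E (fun x : M => TangentSpace I x) x
  let L : E →L[ℝ] ℝ := LinearMap.toContinuousLinearMap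
    { toFun := fun w => inner ℝ w₀ (e.symmL ℝ x w)
      map_add' := fun a b => by rw [map_add, inner_add_right]
      map_smul' := fun a b => by rw [map_smul, inner_smul_right]; rfl }
  have hLapp : ∀ w, L w = inner ℝ w₀ (e.symmL ℝ x w) := fun w => rfl
  let u : M → ℝ := fun y => L (extChartAt I x y)
  have hu : ∀ y ∈ (chartAt H x).source, HasMFDerivAt I 𝓘(ℝ, ℝ) u y
      (L.comp (show TangentSpace I y →L[ℝ] E from mfderiv I 𝓘(ℝ, E) (extChartAt I x) y)) :=
    fun y hy => (L.hasFDerivAt.hasMFDerivAt).comp y (mdifferentiableAt_extChartAt hy).hasMFDerivAt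
  have hself : ∀ v : TangentSpace I x, e.symmL ℝ x (show E from v) = v := by
    intro v
    rw [TangentBundle.symmL_trivializationAt (mem_chart_source H x),
      mfderivWithin_range_extChartAt_symm]
    rfl
  refine ⟨u, L, ?_, ?_, ?_⟩
  · have := hu x (mem_chart_source H x)
    rw [mfderiv_extChartAt_self] at this
    exact this
  · exact (hLapp w₀).trans (by rw [hself w₀, real_inner_self_eq_norm_sq])
  · have hsrc := chart_source_mem_nhds H x
    obtain ⟨R, hR, hball⟩ := Metric.eventually_nhds_iff_ball.1
      ((eventually_norm_symm_mfderiv_extChartAt_le (I := I) x hr).and hsrc)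
    have hR' : 3 * (R / 3) = R := by ring
    have hr0 : 0 ≤ r * ‖w₀‖ := by have := norm_nonneg w₀; positivity
    have hlip : ∀ a ∈ Metric.ball x (R / 3), ∀ b ∈ Metric.ball x (R / 3),
        dist (u a) (u b) ≤ r * ‖w₀‖ * dist a b := fun a ha b hb =>
      dist_le_of_enorm_mfderiv_le (I := I) (I' := 𝓘(ℝ, ℝ)) (h := u) (x₀ := x) (R := R / 3)
        (c := ⟨r * ‖w₀‖, hr0⟩)
      (fun y hy => (hu y (hball y (hR' ▸ hy)).2).mdifferentiableAt)
      (by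
        rw [hR']
        refine (L.contDiff.contMDiff.comp_contMDiffOn contMDiffOn_extChartAt).mono fun y hy => ?_
        exact (hball y hy).2)
      (fun y hy v => by
        obtain ⟨hyb, hys⟩ := hball y (hR' ▸ hy)
        rw [(hu y hys).mfderiv, enorm_tangentSpace_vectorSpace]
        have h1 : ‖L (mfderiv I 𝓘(ℝ, E) (extChartAt I x) y v)‖ ≤ r * ‖w₀‖ * ‖v‖ := by
          refine (congrArg _ (hLapp _)).trans_le ((norm_inner_le_norm _ _).trans ?_)
          rw [mul_comm r, mul_assoc]
          exact mul_le_mul_of_nonneg_left (hyb v) (norm_nonneg _)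
        exact enorm_le_coe_mul_enorm h1) ha hb
    filter_upwards [Metric.ball_mem_nhds x (show 0 < R / 3 by positivity)] with y hy
    exact hlip y hy x (Metric.mem_ball_self (by positivity))

/-- Chart curves: a curve through `x` with velocity `v` which is locally Lipschitz with constant
nearly `‖v‖`. -/
lemma exists_lipschitz_curve [I.Boundaryless] (x : M) (v : TangentSpace I x) {r : ℝ}
    (hr : ‖v‖ < r) :
    ∃ (γ : ℝ → M), γ 0 = x ∧
      HasMFDerivAt 𝓘(ℝ, ℝ) I γ 0 (ContinuousLinearMap.toSpanSingleton ℝ (show E from v)) ∧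
      ∀ᶠ t in 𝓝 (0 : ℝ), dist (γ t) x ≤ r * |t| := by
  set e := trivializationAt E (fun x : M => TangentSpace I x) x with he
  let v' : E := v
  let c : ℝ → E := fun t => extChartAt I x x + t • v'
  have hc : ∀ t, HasFDerivAt c (ContinuousLinearMap.toSpanSingleton ℝ v') t := fun t =>
    ((ContinuousLinearMap.toSpanSingleton ℝ v').hasFDerivAt).const_add _
  have hc0 : c 0 = extChartAt I x x := by simp [c]
  let γ : ℝ → M := (extChartAt I x).symm ∘ c
  have hγ0 : γ 0 = x := by simp [γ, hc0]
  have htgt : ∀ᶠ t in 𝓝 (0 : ℝ), c t ∈ (extChartAt I x).target :=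
    (hc 0).continuousAt.eventually_mem (by rw [hc0]; exact extChartAt_target_mem_nhds x)
  have hsrc : ∀ t, c t ∈ (extChartAt I x).target → γ t ∈ (chartAt H x).source := fun t ht => by
    rw [← extChartAt_source I]; exact (extChartAt I x).map_target ht
  let tnorm : ∀ y : M, TangentSpace I y → ℝ := fun y w => ‖w‖
  let D : ℝ → E →L[ℝ] E := fun t => mfderivWithin 𝓘(ℝ, E) I (extChartAt I x).symm (range I) (c t)
  have hγ : ∀ t, c t ∈ (extChartAt I x).target → HasMFDerivAt 𝓘(ℝ, ℝ) I γ t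
      ((D t).comp (ContinuousLinearMap.toSpanSingleton ℝ v')) := fun t ht =>
    ((mdifferentiableWithinAt_extChartAt_symm ht).hasMFDerivWithinAt.hasMFDerivAt
      (by rw [I.range_eq_univ]; exact univ_mem)).comp t (hc t).hasMFDerivAt
  have hD0 : D 0 = ContinuousLinearMap.id ℝ E := by
    have h : ∀ z, z = extChartAt I x x →
        (mfderivWithin 𝓘(ℝ, E) I (extChartAt I x).symm (range I) z : E →L[ℝ] E) =
          ContinuousLinearMap.id ℝ E := by
      rintro _ rfl
      exact mfderivWithin_range_extChartAt_symm (I := I) (x := x)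
    exact h _ hc0
  -- The velocity of the chart curve is a constant vector read in the trivialization, so its norm
  -- varies continuously along the curve.
  have hD : ∀ t, c t ∈ (extChartAt I x).target → e.symm (γ t) v' = D t v' := by
    intro t ht
    rw [← e.symmL_apply (R := ℝ) (show γ t ∈ e.baseSet from hsrc t ht)]
    have h2 := TangentBundle.symmL_trivializationAt (I := I) (hsrc t ht)
    rw [show extChartAt I x (γ t) = c t from (extChartAt I x).right_inv ht] at h2
    exact congrArg (fun A : E →L[ℝ] E => A v') h2
  have htgt0 : c 0 ∈ (extChartAt I x).target := by rw [hc0]; exact mem_extChartAt_target x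
  have hnorm : ∀ᶠ t in 𝓝 (0 : ℝ), tnorm (γ t) (D t v') < r := by
    have hx : γ 0 ∈ e.baseSet := by
      rw [hγ0]; exact FiberBundle.mem_baseSet_trivializationAt' x
    have h1 : ContinuousAt (fun y : M => (⟨y, e.symm y v'⟩ : TangentBundle I M)) (γ 0) :=
      ContinuousAt.comp (f := fun y : M => (y, v'))
        (e.continuousOn_symm.continuousAt ((e.open_baseSet.prod isOpen_univ).mem_nhds
          ⟨hx, mem_univ _⟩)) (by fun_prop)
    have h1' : ContinuousAt (fun t : ℝ => (⟨γ t, e.symm (γ t) v'⟩ : TangentBundle I M)) 0 :=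
      ContinuousAt.comp (f := γ) (g := fun y : M => (⟨y, e.symm y v'⟩ : TangentBundle I M)) h1
        (hγ 0 htgt0).continuousAt
    have h2 := (continuous_norm_tangentBundle (I := I) (M := M)).continuousAt.tendsto.comp
      h1'.tendsto
    have h4 : ‖e.symm (γ 0) v'‖ < r := by
      have h5 : e.symm (γ 0) v' = v' := (hD 0 htgt0).trans (by rw [hD0]; rfl)
      have h6 : ∀ y, y = x → tnorm y v' < r := by rintro y rfl; exact hr
      exact lt_of_eq_of_lt (congrArg (tnorm (γ 0)) h5) (h6 _ hγ0)
    filter_upwards [h2.eventually_lt_const h4, htgt] with t ht htt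
    exact lt_of_eq_of_lt (congrArg (tnorm (γ t)) (hD t htt).symm) ht
  refine ⟨γ, hγ0, ?_, ?_⟩
  · refine (hγ 0 htgt0).congr_mfderiv ?_
    rw [hD0]
    exact ContinuousLinearMap.id_comp _
  · obtain ⟨R, hR, hball⟩ := Metric.eventually_nhds_iff_ball.1 (hnorm.and htgt)
    have hR' : 3 * (R / 3) = R := by ring
    have hr0 : 0 ≤ r := (norm_nonneg v).trans hr.le
    have hlip : ∀ a ∈ Metric.ball (0 : ℝ) (R / 3), ∀ b ∈ Metric.ball (0 : ℝ) (R / 3),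
        dist (γ a) (γ b) ≤ r * dist a b := fun a ha b hb =>
      dist_le_of_enorm_mfderiv_le (I := 𝓘(ℝ, ℝ)) (I' := I) (h := γ) (x₀ := 0)
      (R := R / 3) (c := ⟨r, hr0⟩)
      (fun t ht => (hγ t (hball t (hR' ▸ ht)).2).mdifferentiableAt)
      (by
        rw [hR']
        refine (contMDiffOn_extChartAt_symm x).comp (t := (extChartAt I x).target) ?_
          fun t ht => (hball t ht).2
        refine ContMDiff.contMDiffOn (ContDiff.contMDiff ?_)
        fun_prop)
      (fun t ht a => by
        obtain ⟨htn, htt⟩ := hball t (hR' ▸ ht)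
        rw [(hγ t htt).mfderiv, enorm_tangentSpace_vectorSpace]
        refine enorm_le_coe_mul_enorm ?_
        let a' : ℝ := a
        have h1 : tnorm (γ t) (a' • D t v') ≤ r * ‖a'‖ := by
          refine (norm_smul a' (show TangentSpace I (γ t) from D t v')).trans_le ?_
          rw [mul_comm]
          exact mul_le_mul_of_nonneg_right htn.le (norm_nonneg _)
        exact (congrArg (tnorm (γ t)) (map_smul (D t) a' v')).trans_le h1) ha hb
    filter_upwards [Metric.ball_mem_nhds (0 : ℝ) (show 0 < R / 3 by positivity)] with t ht
    have := hlip t ht 0 (Metric.mem_ball_self (by positivity))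
    rwa [hγ0, dist_zero_right, Real.norm_eq_abs] at this

/-- The derivative of a map which is `c`-Lipschitz on a neighbourhood has norm at most `c`. -/
lemma norm_mfderiv_le_of_dist_le [FiniteDimensional ℝ E] [I.Boundaryless] {f : M → M} {x : M}
    (hf : MDifferentiableAt I I f x) {O : Set M}
    {c : ℝ} (hc : 0 ≤ c) (hfO : ∀ x ∈ O, ∀ y ∈ O, dist (f x) (f y) ≤ c * dist x y)
    (hx : O ∈ 𝓝 x) (v : TangentSpace I x) :
    ‖(mfderiv I I f x v : TangentSpace I (f x))‖ ≤ c * ‖v‖ := by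
  set w₀ : TangentSpace I (f x) := mfderiv I I f x v with hw₀
  -- With a test function `u` whose differential at `f x` is `⟪w₀, ·⟫` and a curve `γ` of velocity
  -- `v`, the derivative of `u ∘ f ∘ γ` at `0` is `‖w₀‖ ^ 2`. The Lipschitz constants of the three
  -- maps bound it, and `r` then decreases to `1`.
  have key : ∀ r : ℝ, 1 < r → ‖w₀‖ ^ 2 ≤ r * ‖w₀‖ * (c * (‖v‖ + (r - 1))) := by
    intro r hr
    obtain ⟨u, L, hu, hL, hlip⟩ := exists_lipschitz_testFunction (f x) w₀ hr
    obtain ⟨γ, h0, hγ, hγlip⟩ := exists_lipschitz_curve (I := I) x v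
      (show ‖v‖ < ‖v‖ + (r - 1) by linarith)
    have hγc : Tendsto γ (𝓝 0) (𝓝 x) := by simpa [h0] using hγ.continuousAt.tendsto
    have hfd : HasMFDerivAt I I f (γ 0) (mfderiv I I f x) := by rw [h0]; exact hf.hasMFDerivAt
    have hu' : HasMFDerivAt I 𝓘(ℝ, ℝ) u ((f ∘ γ) 0) L := by
      rw [Function.comp_apply, h0]; exact hu
    have hcomp := (hu'.comp 0 (hfd.comp 0 hγ))
    let A : E →L[ℝ] E := mfderiv I I f x
    let v' : E := v
    have hcomp : HasFDerivAt (u ∘ f ∘ γ)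
        (L.comp (A.comp (ContinuousLinearMap.toSpanSingleton ℝ v'))) (0 : ℝ) :=
      hasMFDerivAt_iff_hasFDerivAt.1 hcomp
    have hbound := hcomp.le_of_lip' (C := r * ‖w₀‖ * (c * (‖v‖ + (r - 1)))) (by
      have := norm_nonneg v; have := norm_nonneg w₀
      have : 0 ≤ r - 1 := by linarith
      positivity) (by
      filter_upwards [hγlip, hγc.eventually_mem hx,
        (hf.continuousAt.tendsto.comp hγc).eventually hlip] with t ht htO htu
      have h1 := hfO _ htO _ (mem_of_mem_nhds hx)
      simp only [Function.comp_apply, h0, Real.norm_eq_abs, sub_zero] at htu ⊢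
      refine htu.trans ?_
      calc r * ‖w₀‖ * dist (f (γ t)) (f x)
          ≤ r * ‖w₀‖ * (c * ((‖v‖ + (r - 1)) * |t|)) :=
            mul_le_mul_of_nonneg_left (h1.trans (mul_le_mul_of_nonneg_left ht hc))
              (mul_nonneg (by linarith) (norm_nonneg w₀))
        _ = _ := by ring)
    have h2 : ‖(L.comp (A.comp (ContinuousLinearMap.toSpanSingleton ℝ v'))) (1 : ℝ)‖ ≤
        r * ‖w₀‖ * (c * (‖v‖ + (r - 1))) * ‖(1 : ℝ)‖ :=
      ContinuousLinearMap.le_of_opNorm_le _ hbound (1 : ℝ)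
    have h3 : (L.comp (A.comp (ContinuousLinearMap.toSpanSingleton ℝ v'))) (1 : ℝ) = L w₀ := by
      simp only [ContinuousLinearMap.comp_apply, ContinuousLinearMap.toSpanSingleton_apply,
        one_smul]
      rfl
    rw [h3, hL, norm_one (α := ℝ), mul_one] at h2
    exact (le_abs_self _).trans h2
  have hlim : Tendsto (fun r : ℝ => r * ‖w₀‖ * (c * (‖v‖ + (r - 1)))) (𝓝[>] 1)
      (𝓝 (‖w₀‖ * (c * ‖v‖))) := by
    have : Continuous (fun r : ℝ => r * ‖w₀‖ * (c * (‖v‖ + (r - 1)))) := by fun_prop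
    simpa using (this.tendsto 1).mono_left nhdsWithin_le_nhds
  have h1 : ‖w₀‖ ^ 2 ≤ ‖w₀‖ * (c * ‖v‖) :=
    ge_of_tendsto hlim (by filter_upwards [self_mem_nhdsWithin] with r hr using key r hr)
  rcases (norm_nonneg w₀).eq_or_lt with h0 | h0
  · rw [← h0]; positivity
  · exact le_of_mul_le_mul_left (by linarith [sq ‖w₀‖]) h0

end Riemannian

/-! ### Neighbourhoods in `Diff¹(M)` -/

section Neighbourhoods

open Manifold

variable {n : ℕ} {M : Type*} [MetricSpace M] [ChartedSpace (EuclideanSpace ℝ (Fin n)) M]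
  [IsManifold (𝓡 n) ∞ M]

/-- The `C¹` topology is induced by the compact-open topology on tangent maps, and evaluation is
jointly continuous because the tangent bundle is locally compact. -/
lemma continuous_tangentMap_eval :
    Continuous fun z : Diff1 n M × TangentBundle (𝓡 n) M => tangentMap (𝓡 n) (𝓡 n) z.1 z.2 := by
  have : LocallyCompactSpace (TangentBundle (𝓡 n) M) :=
    Manifold.locallyCompact_of_finiteDimensional (𝓡 n).tangent
  have h : Continuous (Diff1.tangent : Diff1 n M → _) := continuous_induced_dom
  exact (h.comp continuous_fst).eval continuous_snd

/-- The value at `x` is the base point of the image of the zero vector at `x`. -/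
lemma continuous_eval : Continuous fun z : Diff1 n M × M => z.1 z.2 := by
  have h : Continuous fun z : Diff1 n M × M =>
      (tangentMap (𝓡 n) (𝓡 n) z.1 (⟨z.2, 0⟩ : TangentBundle (𝓡 n) M)).proj :=
    (FiberBundle.continuous_proj (EuclideanSpace ℝ (Fin n)) (TangentSpace (𝓡 n) (M := M))).comp
      (continuous_tangentMap_eval.comp (continuous_fst.prodMk
        ((Bundle.contMDiff_zeroSection (n := 0) ℝ (TangentSpace (𝓡 n) (M := M))
          (IB := 𝓡 n)).continuous.comp continuous_snd)))
  exact h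

variable [CompactSpace M]

lemma eventually_dist_apply_lt (f : Diff1 n M) {ε : ℝ} (hε : 0 < ε) :
    ∀ᶠ g in 𝓝 f, ∀ x, dist (g x) (f x) < ε := by
  have h : ∀ᶠ g in 𝓝 f, ∀ x ∈ (univ : Set M), dist (g x) (f x) < ε := by
    refine isCompact_univ.eventually_forall_of_forall_eventually fun x _ => ?_
    have hc : ContinuousAt (fun z : Diff1 n M × M => dist (z.1 z.2) (f z.2)) (f, x) :=
      (continuous_eval.dist (f.continuous.comp continuous_snd)).continuousAt
    exact hc.eventually_lt_const (by simpa using hε)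
  simpa using h

variable [RiemannianBundle (fun x : M => TangentSpace (𝓡 n) x)] [IsRiemannianManifold (𝓡 n) M]
  [IsContinuousRiemannianBundle (EuclideanSpace ℝ (Fin n)) (fun x : M => TangentSpace (𝓡 n) x)]

/-- Contraction on the closure of an open set is a `C¹`-open condition, up to increasing the
contraction constant. -/
lemma eventually_dist_le_mul (f : Diff1 n M) {D : Set M} (hD : IsOpen D) {c c' : ℝ} (hc : 0 ≤ c)
    (hcc : c < c')
    (hf : ∀ x ∈ closure D, ∀ y ∈ closure D, dist (f x) (f y) ≤ c * dist x y) :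
    ∀ᶠ g in 𝓝 f, ∀ x ∈ closure D, ∀ y ∈ closure D, dist (g x) (g y) ≤ c' * dist x y := by
  have hsm : ∀ g : Diff1 n M, ContMDiff (𝓡 n) (𝓡 n) 1 g := fun g => g.contMDiff
  have hderiv : ∀ x ∈ closure D, ∀ v : TangentSpace (𝓡 n) x,
      ‖(mfderiv (𝓡 n) (𝓡 n) f x v : TangentSpace (𝓡 n) (f x))‖ ≤ c * ‖v‖ := by
    have hcl : IsClosed {V : TangentBundle (𝓡 n) M |
        ‖(tangentMap (𝓡 n) (𝓡 n) f V).2‖ ≤ c * ‖V.2‖} :=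
      isClosed_le (continuous_norm_tangentBundle.comp ((hsm f).continuous_tangentMap le_rfl))
        (continuous_const.mul continuous_norm_tangentBundle)
    -- The Lipschitz bound controls the derivative over the open set `D`. As the bundle projection
    -- is open, vectors over `closure D` are limits of vectors over `D`, and the closed condition
    -- passes to them.
    have hsub : (fun V : TangentBundle (𝓡 n) M => V.1) ⁻¹' closure D ⊆
        {V : TangentBundle (𝓡 n) M | ‖(tangentMap (𝓡 n) (𝓡 n) f V).2‖ ≤ c * ‖V.2‖} := by
      refine ((FiberBundle.isOpenMap_proj (EuclideanSpace ℝ (Fin n))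
        (TangentSpace (𝓡 n) (M := M))).preimage_closure_subset_closure_preimage).trans
        (closure_minimal (fun V hV => ?_) hcl)
      exact norm_mfderiv_le_of_dist_le ((hsm f).mdifferentiableAt one_ne_zero) hc
        (fun x hx y hy => hf x (subset_closure hx) y (subset_closure hy)) (hD.mem_nhds hV) V.2
    intro x hx v
    exact hsub (show (⟨x, v⟩ : TangentBundle (𝓡 n) M) ∈ _ from hx)
  have hloc : ∀ x ∈ closure D, ∃ R > 0, ∀ᶠ g in 𝓝 f, ∀ a ∈ Metric.ball x R,
      ∀ b ∈ Metric.ball x R, dist (g a) (g b) ≤ c' * dist a b := by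
    intro x hx
    have hev := eventually_norm_mfderiv_le (G := fun g : Diff1 n M => (g : M → M)) (p₀ := f)
      (x₀ := x) hcc (fun v => continuous_tangentMap_eval.continuousAt) (hderiv x hx)
    obtain ⟨U, hU, A, hA, hUA⟩ := mem_nhds_prod_iff.1 hev
    obtain ⟨R, hR, hRA⟩ := Metric.mem_nhds_iff.1 hA
    refine ⟨R / 3, by positivity, ?_⟩
    filter_upwards [hU] with g hg a ha b hb
    refine dist_le_of_enorm_mfderiv_le (I := 𝓡 n) (I' := 𝓡 n) (h := g) (x₀ := x) (R := R / 3)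
      (c := ⟨c', hc.trans hcc.le⟩) (fun y _ => (hsm g).mdifferentiableAt one_ne_zero)
      (hsm g).contMDiffOn (fun y hy v => enorm_le_coe_mul_enorm ?_) ha hb
    exact hUA (show (g, y) ∈ U ×ˢ A from ⟨hg,
      hRA (by rwa [mul_div_cancel₀ _ three_ne_zero] at hy)⟩) v
  choose! R hR hRg using hloc
  have hK : IsCompact (closure D) := isClosed_closure.isCompact
  obtain ⟨t, ht, htK⟩ := hK.elim_nhds_subcover (fun x => Metric.ball x (R x))
    fun x hx => Metric.ball_mem_nhds x (hR x hx)
  obtain ⟨δ, hδ, hleb⟩ := lebesgue_number_lemma_of_metric hK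
    (c := fun x : t => Metric.ball x.1 (R x)) (fun _ => Metric.isOpen_ball)
    (by simpa only [iUnion_subtype] using htK)
  -- Pairs closer than the Lebesgue number `δ` lie in a common ball, where the derivative bound
  -- applies. For the other pairs `C⁰`-closeness suffices: the two errors add up to at most `(c' -
  -- c) * dist x y`.
  have hε : 0 < (c' - c) * δ / 2 := by have := sub_pos.2 hcc; positivity
  filter_upwards [(Finset.eventually_all t).2 fun x hx => hRg x (ht x hx),
    eventually_dist_apply_lt f hε] with g hg hgf x hx y hy
  rcases lt_or_ge (dist y x) δ with hlt | hge
  · obtain ⟨i, hi⟩ := hleb x hx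
    exact hg i.1 i.2 x (hi (Metric.mem_ball_self hδ)) y (hi hlt)
  · have h1 := dist_triangle4 (g x) (f x) (f y) (g y)
    have h2 := hf x hx y hy
    have h3 := hgf x
    have h4 := hgf y
    rw [dist_comm (g y)] at h4
    rw [dist_comm y] at hge
    nlinarith [mul_le_mul_of_nonneg_left hge (sub_pos.2 hcc).le]

end Neighbourhoods

/-! ### Repelling fixed points -/

section Powers

/-- Powers of an element with spectrum in the open unit disk tend to zero. -/
lemma tendsto_pow_zero_of_spectrum {A : Type*} [NormedRing A] [NormedAlgebra ℂ A] [CompleteSpace A]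
    (a : A) (h : ∀ z ∈ spectrum ℂ a, ‖z‖ < 1) : Tendsto (fun n : ℕ => a ^ n) atTop (𝓝 0) := by
  cases subsingleton_or_nontrivial A
  · exact tendsto_const_nhds.congr fun _ => Subsingleton.elim 0 _
  have h1 : spectralRadius ℂ a < ((1 : NNReal) : ENNReal) :=
    spectrum.spectralRadius_lt_of_forall_lt a fun z hz => h z hz
  obtain ⟨r, hr, hr1⟩ := ENNReal.lt_iff_exists_nnreal_btwn.1 h1
  have hr1' : r < 1 := ENNReal.coe_lt_coe.1 hr1
  have h2 := (spectrum.pow_nnnorm_pow_one_div_tendsto_nhds_spectralRadius a).eventually_lt_const hr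
  refine squeeze_zero_norm' ?_ (tendsto_pow_atTop_nhds_zero_of_lt_one r.coe_nonneg
    (by exact_mod_cast hr1'))
  filter_upwards [h2, eventually_gt_atTop 0] with n hn hn0
  have hn0' : (n : ℝ) ≠ 0 := by positivity
  have h3 : ((‖a ^ n‖₊ : ENNReal) ^ (1 / n : ℝ)) ^ (n : ℝ) ≤ (r : ENNReal) ^ (n : ℝ) :=
    ENNReal.rpow_le_rpow hn.le (by positivity)
  rw [← ENNReal.rpow_mul, one_div_mul_cancel hn0', ENNReal.rpow_one, ENNReal.rpow_natCast] at h3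
  exact_mod_cast h3

open scoped Matrix.Norms.L2Operator in
/-- Powers of the inverse of a linear map all of whose complex eigenvalues have modulus greater
than one tend to zero. -/
lemma tendsto_pow_zero_of_charpoly {n : ℕ}
    (A B : EuclideanSpace ℝ (Fin n) →L[ℝ] EuclideanSpace ℝ (Fin n)) (hBA : B * A = 1)
    (hA : ∀ z : ℂ, Polynomial.aeval z A.toLinearMap.charpoly = 0 → 1 < ‖z‖) :
    Tendsto (fun N : ℕ => B ^ N) atTop (𝓝 0) := by
  -- Gelfand's formula is applied in a complex Banach algebra. The operators are therefore turned
  -- into real matrices and complexified, where the spectrum of the inverse consists of the inverted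
  -- eigenvalues; entrywise real parts lead back.
  let Φ := Matrix.toEuclideanCLM (n := Fin n) (𝕜 := ℝ)
  set a := Φ.symm A with ha
  set b := Φ.symm B with hb
  have hba : b * a = 1 := by rw [ha, hb, ← map_mul, hBA, map_one]
  let f : ℝ →+* ℂ := Complex.ofRealHom
  have hchar : a.charpoly = A.toLinearMap.charpoly := by
    have h1 : Φ a = A := Φ.apply_symm_apply A
    rw [← h1, Matrix.coe_toEuclideanCLM_eq_toEuclideanLin, show Matrix.toEuclideanLin a = Matrix.toLin _ _ a
      from DFunLike.congr_fun (Matrix.toLpLin_eq_toLin 2 2) a,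
      Matrix.charpoly_toLin]
  let a' := a.map f
  let b' := b.map f
  have hba' : b' * a' = 1 := by
    rw [← Matrix.map_mul, hba, Matrix.map_one _ (map_zero f) (map_one f)]
  let u : (Matrix (Fin n) (Fin n) ℂ)ˣ := ⟨a', b', mul_eq_one_comm.1 hba', hba'⟩
  have hspec : ∀ z ∈ spectrum ℂ b', ‖z‖ < 1 := by
    intro z hz
    have hz0 : z ≠ 0 := spectrum.ne_zero_of_mem_of_unit (a := u⁻¹) hz
    have h1 : z⁻¹ ∈ spectrum ℂ a' := spectrum.inv₀_mem_iff (a := u).2 hz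
    rw [Matrix.mem_spectrum_iff_isRoot_charpoly, Matrix.charpoly_map, hchar,
      Polynomial.IsRoot.def, Polynomial.eval_map] at h1
    have h2 := hA z⁻¹ h1
    rw [norm_inv] at h2
    exact (one_lt_inv₀ (norm_pos_iff.2 hz0)).1 h2
  have hlim := tendsto_pow_zero_of_spectrum b' hspec
  have hre : Tendsto (fun N : ℕ => (b' ^ N).map Complex.re) atTop
      (𝓝 ((0 : Matrix _ _ ℂ).map Complex.re)) :=
    ((Continuous.matrix_map continuous_id Complex.continuous_re).tendsto _).comp hlim
  have hpow : ∀ N : ℕ, (b' ^ N).map Complex.re = b ^ N := by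
    intro N
    rw [← Matrix.map_pow]
    ext i j
    simp [f]
  simp only [hpow] at hre
  have hΦ : Continuous Φ := (AddMonoidHomClass.isometry_of_norm Φ
    fun A => (Matrix.l2_opNorm_toEuclideanCLM A)).continuous
  have h3 := (hΦ.tendsto _).comp hre
  have h4 : Φ ((0 : Matrix (Fin n) (Fin n) ℂ).map Complex.re) = 0 := by
    rw [Matrix.map_zero _ Complex.zero_re, map_zero]
  rw [h4] at h3
  refine h3.congr fun N => ?_
  simp only [Function.comp_apply, map_pow, hb]
  rw [show Φ (Φ.symm B) = B from Φ.apply_symm_apply B]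

end Powers

/-! ### Trapping neighbourhoods of repelling fixed points -/

section Trapping

open Manifold

variable {n : ℕ} {M : Type*} [MetricSpace M] [ChartedSpace (EuclideanSpace ℝ (Fin n)) M]
  [IsManifold (𝓡 n) ∞ M]

omit [IsManifold (𝓡 n) ∞ M] in
/-- In the chart at a repelling fixed point, some iterate of the inverse contracts towards it. -/
lemma Diff1.IsRepelling.exists_pow_le {f : Diff1 n M} {q : M} (hq : f.IsRepelling q) :
    ∃ N : ℕ, 0 < N ∧ ∀ᶠ y in 𝓝 (extChartAt (𝓡 n) q q),
      ‖((extChartAt (𝓡 n) q ∘ f.symm ∘ (extChartAt (𝓡 n) q).symm)^[N] y) - extChartAt (𝓡 n) q q‖ ≤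
        3 / 4 * ‖y - extChartAt (𝓡 n) q q‖ := by
  obtain ⟨hfix, heig⟩ := hq
  set e := extChartAt (𝓡 n) q
  set F := e ∘ f.symm ∘ e.symm with hF
  have hfix' : f.symm q = q := by
    have := f.symm_apply_apply q
    rwa [hfix] at this
  let A : EuclideanSpace ℝ (Fin n) →L[ℝ] EuclideanSpace ℝ (Fin n) := mfderiv (𝓡 n) (𝓡 n) f q
  let B : EuclideanSpace ℝ (Fin n) →L[ℝ] EuclideanSpace ℝ (Fin n) := mfderiv (𝓡 n) (𝓡 n) f.symm q
  have hd : ∀ g : Diff1 n M, MDifferentiable (𝓡 n) (𝓡 n) g :=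
    fun g => g.contMDiff.mdifferentiable one_ne_zero
  have hBA : B * A = 1 := by
    have h1 := mfderiv_comp q (hd f.symm (f q)) (hd f q)
    have h2 : (f.symm : M → M) ∘ f = id := funext fun x => f.symm_apply_apply x
    rw [h2, mfderiv_id] at h1
    have h3 : ∀ p, p = q → (mfderiv (𝓡 n) (𝓡 n) f.symm p :
        EuclideanSpace ℝ (Fin n) →L[ℝ] EuclideanSpace ℝ (Fin n)) = B := by
      rintro _ rfl; rfl
    have h4 := congrArg (fun C : EuclideanSpace ℝ (Fin n) →L[ℝ] EuclideanSpace ℝ (Fin n) =>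
      C.comp A) (h3 _ hfix)
    exact (h1.trans h4).symm
  have hFd : HasFDerivAt F B (e q) := by
    have h1 := (hd f.symm q).hasMFDerivAt.2
    rw [writtenInExtChartAt, hfix'] at h1
    exact h1.hasFDerivAt (by simp)
  have hFe : F (e q) = e q := by simp [hF, e, hfix']
  obtain ⟨N, hN, hN0⟩ := (((tendsto_pow_zero_of_charpoly A B hBA heig).eventually
    (Metric.ball_mem_nhds 0 (show (0 : ℝ) < 1 / 2 by norm_num))).and
      (eventually_gt_atTop 0)).exists
  rw [dist_zero_right] at hN
  refine ⟨N, hN0, ?_⟩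
  -- The factor `3 / 4` is the sum of `‖B ^ N‖ < 1 / 2` and the differentiability error `1 / 4`.
  have h1 := (hFd.iterate hFe N).isLittleO.def (show (0 : ℝ) < 1 / 4 by norm_num)
  rw [Function.iterate_fixed hFe] at h1
  filter_upwards [h1] with y hy
  have h2 := (B ^ N).le_of_opNorm_le hN.le (y - e q)
  have h3 := norm_add_le (F^[N] y - e q - (B ^ N) (y - e q)) ((B ^ N) (y - e q))
  rw [sub_add_cancel] at h3
  linarith

omit [IsManifold (𝓡 n) ∞ M] in
/-- A repelling fixed point has arbitrarily small compact neighbourhoods which are mapped into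
their interior by an iterate of the inverse. -/
lemma Diff1.IsRepelling.exists_trapping {f : Diff1 n M} {q : M} (hq : f.IsRepelling q) {A : Set M}
    (hA : A ∈ 𝓝 q) :
    ∃ (K O : Set M) (N : ℕ), IsCompact K ∧ IsOpen O ∧ q ∈ O ∧ O ⊆ K ∧ K ⊆ A ∧ 0 < N ∧
      ∀ x ∈ K, f.symm^[N] x ∈ O := by
  obtain ⟨N, hN0, hN⟩ := hq.exists_pow_le
  have hfix' : f.symm q = q := by
    have := f.symm_apply_apply q
    rwa [hq.1] at this
  set e := extChartAt (𝓡 n) q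
  set F := e ∘ f.symm ∘ e.symm with hF
  have hsymm : Tendsto e.symm (𝓝 (e q)) (𝓝 q) := by
    simpa [e] using (continuousAt_extChartAt_symm (I := 𝓡 n) q).tendsto
  -- Iterates of the chart expression `F` represent iterates of `f.symm` only while all intermediate
  -- points remain in the chart.
  have hsrc : ∀ᶠ y in 𝓝 (e q), ∀ j ∈ Finset.range (N + 1), f.symm^[j] (e.symm y) ∈ e.source := by
    refine (Finset.eventually_all _).2 fun j _ => ?_
    have h1 : Tendsto (fun y => f.symm^[j] (e.symm y)) (𝓝 (e q)) (𝓝 q) := by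
      have h2 := (f.symm.continuous.iterate j).tendsto q
      rw [Function.iterate_fixed hfix'] at h2
      exact h2.comp hsymm
    exact h1.eventually_mem (extChartAt_source_mem_nhds q)
  obtain ⟨r, hr, hball⟩ := Metric.eventually_nhds_iff_ball.1
    (((hN.and hsrc).and (hsymm.eventually_mem hA)).and
      ((extChartAt_target_mem_nhds (I := 𝓡 n) q)))
  have hsub : Metric.closedBall (e q) (r / 2) ⊆ Metric.ball (e q) r :=
    Metric.closedBall_subset_ball (by linarith)
  refine ⟨e.symm '' Metric.closedBall (e q) (r / 2),
    (chartAt (EuclideanSpace ℝ (Fin n)) q).source ∩ e ⁻¹' Metric.ball (e q) (r / 2), N, ?_,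
    isOpen_extChartAt_preimage q Metric.isOpen_ball, ⟨mem_chart_source _ q,
      Metric.mem_ball_self (by positivity)⟩, ?_, ?_, hN0, ?_⟩
  · refine (isCompact_closedBall _ _).image_of_continuousOn
      ((continuousOn_extChartAt_symm q).mono fun y hy => (hball y (hsub hy)).2)
  · rintro x ⟨hxs, hx⟩
    exact ⟨e x, Metric.ball_subset_closedBall hx, e.left_inv (by rwa [extChartAt_source])⟩
  · rintro _ ⟨y, hy, rfl⟩
    exact (hball y (hsub hy)).1.2
  · rintro _ ⟨y, hy, rfl⟩
    obtain ⟨⟨⟨hyN, hys⟩, -⟩, hyt⟩ := hball y (hsub hy)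
    have hiter : ∀ j ≤ N, F^[j] y = e (f.symm^[j] (e.symm y)) := by
      intro j
      induction j with
      | zero => exact fun _ => (e.right_inv hyt).symm
      | succ j ih =>
        intro hj
        rw [Function.iterate_succ_apply', ih (by omega), Function.iterate_succ_apply']
        simp only [hF, Function.comp_apply]
        rw [e.left_inv (hys j (by simp; omega))]
    have h1 := hys N (by simp)
    refine ⟨by rwa [← extChartAt_source (𝓡 n)], ?_⟩
    rw [mem_preimage, ← hiter N le_rfl, Metric.mem_ball, dist_eq_norm]
    rw [Metric.mem_closedBall, dist_eq_norm] at hy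
    have := norm_nonneg (y - e q)
    linarith

variable [CompactSpace M]

/-- The continuation of a repelling fixed point with dense unstable manifold stays close to it. -/
lemma Diff1.IsRepelling.eventually_mem {f : Diff1 n M} {q : M} (hq : f.IsRepelling q) {A : Set M}
    (hA : A ∈ 𝓝 q) :
    ∀ᶠ g in 𝓝 f, ∀ p, g p = p → Dense (Diff1.unstableManifold g p) → p ∈ A := by
  obtain ⟨K, O, N, hK, hO, hqO, hOK, hKA, hN0, hKO⟩ := hq.exists_trapping hA
  have hcont : Continuous fun z : Diff1 n M × M => (z.1)^[N] z.2 := by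
    clear hKO hN0
    induction N with
    | zero => exact continuous_snd
    | succ N ih =>
      simp only [Function.iterate_succ_apply']
      exact continuous_eval.comp (continuous_fst.prodMk ih)
  -- The trapping condition is restated by complements for the forward iterate, so that openness in
  -- `g` needs no continuity of `g ↦ g.symm`.
  have hev : ∀ᶠ g : Diff1 n M in 𝓝 f, ∀ x ∈ Oᶜ, g^[N] x ∈ Kᶜ := by
    refine hO.isClosed_compl.isCompact.eventually_forall_of_forall_eventually fun x hx => ?_
    refine hcont.continuousAt.eventually_mem (hK.isClosed.isOpen_compl.mem_nhds fun hxK => hx ?_)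
    have h1 := hKO _ hxK
    rwa [(Function.LeftInverse.iterate f.symm_apply_apply N) x] at h1
  filter_upwards [hev] with g hg p hp hd
  obtain ⟨x, hxO, hx⟩ := hd.exists_mem_open hO ⟨q, hqO⟩ |>.imp fun _ h => h.symm
  have hback : ∀ y ∈ K, g.symm^[N] y ∈ O := by
    intro y hy
    by_contra hyO
    exact hg _ hyO (by rwa [(Function.RightInverse.iterate (g := g.symm) g.apply_symm_apply N) y])
  have hmem : ∀ m : ℕ, g.symm^[N * m] x ∈ K := by
    intro m
    induction m with
    | zero => exact hOK hxO
    | succ m ih =>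
      rw [mul_add, mul_one, add_comm, Function.iterate_add_apply]
      exact hOK (hback _ ih)
  refine hKA (hK.isClosed.mem_of_tendsto ((tendsto_iff_dist_tendsto_zero.2 hx).comp
    (tendsto_id.const_mul_atTop' hN0)) (Eventually.of_forall hmem))

end Trapping

/-! ### Robustness of the hypotheses -/

section Robustness

variable {n : ℕ} {M : Type*} [MetricSpace M] [CompactSpace M]
  [ChartedSpace (EuclideanSpace ℝ (Fin n)) M] [IsManifold (𝓡 n) ∞ M]

/-- The continuation of a contracting fixed point with dense stable manifold stays close to it. -/
lemma eventually_mem_closedBall {f : Diff1 n M} {a : M} (ha : f a = a) {r θ : ℝ} (hr : 0 < r)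
    (hθ0 : 0 ≤ θ) (hθ : θ < 1)
    (hf : ∀ x ∈ Metric.closedBall a r, dist (f x) (f a) ≤ θ * dist x a) :
    ∀ᶠ g in 𝓝 f, ∀ p, Dense (Diff1.stableManifold g p) → p ∈ Metric.closedBall a r := by
  -- With this margin a perturbation maps the closed ball into itself, since `(1 - θ) * r + θ * r =
  -- r`. A point of the dense stable manifold then starts in the ball and converges to `p` inside
  -- it.
  have hε : 0 < (1 - θ) * r := mul_pos (sub_pos.2 hθ) hr
  filter_upwards [eventually_dist_apply_lt f hε] with g hg p hd
  have hmaps : ∀ x ∈ Metric.closedBall a r, g x ∈ Metric.closedBall a r := by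
    intro x hx
    have h1 := hf x hx
    have h2 := hg x
    have h3 := dist_triangle (g x) (f x) a
    rw [ha] at h1
    rw [Metric.mem_closedBall] at hx ⊢
    nlinarith [mul_le_mul_of_nonneg_left hx hθ0]
  obtain ⟨x, hx, hxp⟩ := hd.exists_mem_open Metric.isOpen_ball ⟨a, Metric.mem_ball_self hr⟩
    |>.imp fun _ h => h.symm
  have hmem : ∀ m : ℕ, g^[m] x ∈ Metric.closedBall a r := by
    intro m
    induction m with
    | zero => exact Metric.ball_subset_closedBall hx
    | succ m ih => rw [Function.iterate_succ_apply']; exact hmaps _ ih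
  exact Metric.isClosed_closedBall.mem_of_tendsto (tendsto_iff_dist_tendsto_zero.2 hxp)
    (Eventually.of_forall hmem)

lemma eventually_mapsTo_closure {f : Diff1 n M} {D : Set M} (hD : IsOpen D)
    (hf : f '' closure D ⊆ D) : ∀ᶠ g : Diff1 n M in 𝓝 f, MapsTo g (closure D) (closure D) := by
  refine (isClosed_closure.isCompact.eventually_forall_of_forall_eventually (P := fun g x =>
    (g : Diff1 n M) x ∈ closure D) fun x hx => ?_)
  exact ((continuous_eval (n := n) (M := M)).continuousAt (x := (f, x))).eventually_mem
    (mem_of_superset (hD.mem_nhds (hf (mem_image_of_mem f hx))) subset_closure)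

omit [IsManifold (𝓡 n) ∞ M] in
/-- The covering property of finitely many diffeomorphisms holds with a margin. -/
lemma exists_cover_margin {ι : Type*} {S : Set ι} {φ : ι → Diff1 n M} {B : Set M} (hB : IsOpen B)
    (hcover : closure B ⊆ ⋃ i ∈ S, φ i '' B) :
    ∃ ρ > 0, ∀ y ∈ B, ∃ i ∈ S, ∀ g : M ≃ₜ M, (∀ x, dist (g x) (φ i x) < ρ) →
      ∀ z, dist z y < ρ → ∃ w ∈ B, g w = z := by
  obtain ⟨δ, hδ, hleb⟩ := lebesgue_number_lemma_of_metric (isClosed_closure (s := B)).isCompact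
    (c := fun i : S => φ i '' B) (fun i => (φ i).toHomeomorph.isOpenMap _ hB)
    (by simpa only [iUnion_subtype] using hcover)
  -- Half of the Lebesgue number is for the distance from `z` to `y`, half for that from `g` to `φ
  -- i`; so `φ i (g.symm z)` lies in `φ i '' B`, and injectivity puts `g.symm z` in `B`.
  refine ⟨δ / 2, half_pos hδ, fun y hy => ?_⟩
  obtain ⟨i, hi⟩ := hleb y (subset_closure hy)
  refine ⟨i, i.2, fun g hg z hz => ?_⟩
  have h1 : φ i (g.symm z) ∈ φ i '' B := by
    refine hi ?_
    have h2 := hg (g.symm z)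
    rw [g.apply_symm_apply, dist_comm] at h2
    have h3 := dist_triangle (φ i (g.symm z)) z y
    rw [Metric.mem_ball]
    linarith
  obtain ⟨w, hw, hwz⟩ := h1
  exact ⟨w, hw, by rw [(φ i).injective hwz, g.apply_symm_apply]⟩

section Riemannian

variable [RiemannianBundle (fun x : M => TangentSpace (𝓡 n) x)] [IsRiemannianManifold (𝓡 n) M]
  [IsContinuousRiemannianBundle (EuclideanSpace ℝ (Fin n)) (fun x : M => TangentSpace (𝓡 n) x)]

/-- Contracting covers by one-step maps are robust. -/
lemma exists_isContractingCover {d : ℕ} {S : Set (Fin d)} {φ : Fin d → Diff1 n M} {D B : Set M}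
    {c : ℝ} (hD : IsOpen D) (hB : IsOpen B) (hBD : B ⊆ D) (hc0 : 0 ≤ c) (hc1 : c < 1)
    (hlip : ∀ i ∈ S, ∀ x ∈ closure D, ∀ y ∈ closure D, dist (φ i x) (φ i y) ≤ c * dist x y)
    (hmaps : ∀ i ∈ S, φ i '' closure D ⊆ D) (hcover : closure B ⊆ ⋃ i ∈ S, φ i '' B)
    {r : ℝ} (hr : 0 < r) :
    ∃ (U : Fin d → Set (Diff1 n M)) (θ ρ : ℝ), (∀ i, U i ∈ 𝓝 (φ i)) ∧ 0 < ρ ∧ ρ ≤ r ∧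
      ∀ Ψ : C1SkewProduct d n M, (∀ ξ, Ψ.fiber ξ ∈ U (ξ 0)) →
        Ψ.toSkewProduct.IsContractingCover S (closure D) B θ ρ := by
  obtain ⟨θ, hcθ, hθ1⟩ := exists_between hc1
  obtain ⟨ρ, hρ, hcov⟩ := exists_cover_margin hB hcover
  refine ⟨fun i => {g | (∀ x, dist (g x) (φ i x) < ρ) ∧ (i ∈ S → MapsTo g (closure D) (closure D) ∧
    ∀ x ∈ closure D, ∀ y ∈ closure D, dist (g x) (g y) ≤ θ * dist x y)}, θ, min ρ r, fun i => ?_,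
    lt_min hρ hr, min_le_right _ _, fun Ψ hΨ => ?_⟩
  · by_cases hi : i ∈ S
    · filter_upwards [eventually_dist_apply_lt (φ i) hρ, eventually_mapsTo_closure hD (hmaps i hi),
        eventually_dist_le_mul (φ i) hD hc0 hcθ (hlip i hi)] with g h1 h2 h3
      exact ⟨h1, fun _ => ⟨h2, h3⟩⟩
    · filter_upwards [eventually_dist_apply_lt (φ i) hρ] with g h1
      exact ⟨h1, fun h => absurd h hi⟩
  · refine ⟨hc0.trans hcθ.le, hθ1, hBD.trans subset_closure, fun ξ hξ => ((hΨ ξ).2 hξ).1,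
      fun ξ hξ => ((hΨ ξ).2 hξ).2, fun y hy => ?_⟩
    obtain ⟨i, hi, h⟩ := hcov y hy
    refine ⟨i, hi, fun ξ hξ z hz => h (Ψ.fiber ξ).toHomeomorph ?_ z (hz.trans_le (min_le_left _ _))⟩
    subst hξ
    exact (hΨ ξ).1

end Riemannian

-- The bound on the infimum `holderConst` yields an actual admissible constant below `ε`.
omit [CompactSpace M] [IsManifold (𝓡 n) ∞ M] in
lemma MemPHS.exists_isDominated {d : ℕ} {ν α lam bet ε : ℝ} {Ψ : C1SkewProduct d n M}
    (h : MemPHS ν α lam bet Ψ) (hν0 : 0 < ν) (hν1 : ν < 1) (hα0 : 0 < α)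
    (hε : Ψ.toSkewProduct.holderConst ν α univ < ε) :
    ∃ C < ε, Ψ.toSkewProduct.IsDominated ν α lam bet C := by
  obtain ⟨hlam, -, hbet, hbet', hS⟩ := h
  obtain ⟨C, hC, hCε⟩ := exists_lt_of_csInf_lt hS.holder hε
  have hlip : ∀ ξ x y, lam * dist x y ≤ dist (Ψ.fiber ξ x) (Ψ.fiber ξ y) ∧
      dist (Ψ.fiber ξ x) (Ψ.fiber ξ y) ≤ bet * dist x y := by
    intro ξ x y
    rcases eq_or_ne x y with rfl | hxy
    · simp
    · have h1 := hS.biLip ξ x (by simp) y (by simp) hxy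
      exact ⟨h1.1.le, h1.2.le⟩
  refine ⟨C, hCε, hν0, hν1, hα0, hlam, ?_, one_pos.trans hbet, fun ξ x y => (hlip ξ x y).1,
    fun ξ x y => (hlip ξ x y).2, hC⟩
  rw [Real.rpow_neg hν0.le] at hbet'
  exact (lt_inv_comm₀ (one_pos.trans hbet) (Real.rpow_pos_of_pos hν0 α)).1 hbet'

omit [CompactSpace M] in
lemma RobustlyAt.mono {ν α lam bet : ℝ} {d : ℕ} {φ : Fin d → Diff1 n M}
    {P Q : C1SkewProduct d n M → Prop} (h : RobustlyAt ν α lam bet φ P) (hPQ : ∀ Ψ, P Ψ → Q Ψ) :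
    RobustlyAt ν α lam bet φ Q := by
  obtain ⟨U, hU, ε, hε, h⟩ := h
  exact ⟨U, hU, ε, hε, fun Ψ h1 h2 h3 => hPQ Ψ (h Ψ h1 h2 h3)⟩

omit [CompactSpace M] [IsManifold (𝓡 n) ∞ M] in
lemma C1SkewProduct.map_const_eq_iff {d : ℕ} (Ψ : C1SkewProduct d n M) (s : Fin d) (x : M) :
    Ψ.toSkewProduct.map ((fun _ => s), x) = ((fun _ => s), x) ↔ Ψ.fiber (fun _ => s) x = x :=
  ⟨fun h => congrArg Prod.snd h, fun h => Prod.ext rfl h⟩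

variable [RiemannianBundle (fun x : M => TangentSpace (𝓡 n) x)] [IsRiemannianManifold (𝓡 n) M]
  [IsContinuousRiemannianBundle (EuclideanSpace ℝ (Fin n)) (fun x : M => TangentSpace (𝓡 n) x)]

/-- A contracting cover by fibre maps, together with an attracting and a repelling fixed point in
the covered region having robustly dense invariant manifolds, yields robust density of the stable
and unstable sets of a fixed point, and robust mixing. -/
lemma exists_robustlyAt_dense_mixing {ν α lam bet : ℝ} (hν0 : 0 < ν) (hν1 : ν < 1) (hα0 : 0 < α)
    (hlam : ν ^ α < lam) (hbet : 1 < bet) (hbet' : bet < ν ^ (-α))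
    {d : ℕ} {S : Set (Fin d)} {φ : Fin d → Diff1 n M} {D B : Set M}
    {c : ℝ} (hD : IsOpen D) (hB : IsOpen B) (hBD : B ⊆ D) (hc0 : 0 ≤ c) (hc1 : c < 1)
    (hlip : ∀ i ∈ S, ∀ x ∈ closure D, ∀ y ∈ closure D, dist (φ i x) (φ i y) ≤ c * dist x y)
    (hmaps : ∀ i ∈ S, φ i '' closure D ⊆ D) (hcover : closure B ⊆ ⋃ i ∈ S, φ i '' B)
    {s t : Fin d} (hs : s ∈ S) {a q : M} (haB : a ∈ B) (ha : φ s a = a)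
    (had : (φ s).StableRobustlyDense a) (hqB : q ∈ B) (hq : (φ t).IsRepelling q)
    (hqd : (φ t).UnstableRobustlyDense q) :
    ∃ W ∈ 𝓝 a, RobustlyAt ν α lam bet φ fun Ψ =>
      (∃ p' ∈ W, (∀ x ∈ W,
          Ψ.toSkewProduct.map ((fun _ => s), x) = ((fun _ => s), x) ↔ x = p') ∧
        Dense (Ψ.toSkewProduct.stableSet ν ((fun _ => s), p')) ∧
        Dense (Ψ.toSkewProduct.unstableSet ν ((fun _ => s), p'))) ∧
      Ψ.toSkewProduct.TopMixing := by
  obtain ⟨W, hW, hWev⟩ := had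
  obtain ⟨W', -, hWev'⟩ := hqd
  obtain ⟨r₁, hr₁, hr₁B⟩ := Metric.isOpen_iff.1 hB a haB
  obtain ⟨r₂, hr₂, hr₂B⟩ := Metric.isOpen_iff.1 hB q hqB
  obtain ⟨U, θ, ρ, hU, hρ, hρr, hcc⟩ :=
    exists_isContractingCover hD hB hBD hc0 hc1 hlip hmaps hcover (half_pos hr₂)
  have hBK : B ⊆ closure D := hBD.trans subset_closure
  -- The neighbourhoods `W` and `W'` of the hypotheses may be large, so they do not place the
  -- continuations near `a` and `q`; this and the next estimate do.
  have haev := eventually_mem_closedBall ha (r := r₁ / 3) (by positivity) hc0 hc1 fun x hx =>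
    hlip s hs x (hBK (hr₁B (Metric.closedBall_subset_ball (by linarith) hx))) a (hBK haB)
  have hqev := hq.eventually_mem (Metric.ball_mem_nhds q (half_pos hr₂))
  have hbetν : ν ^ α < bet⁻¹ := by
    rw [Real.rpow_neg hν0.le] at hbet'
    exact (lt_inv_comm₀ (one_pos.trans hbet) (Real.rpow_pos_of_pos hν0 α)).1 hbet'
  have h1 : 0 < lam - ν ^ α := sub_pos.2 hlam
  have h2 : 0 < bet⁻¹ - ν ^ α := sub_pos.2 hbetν
  refine ⟨W, hW, fun i => U i ∩ ({g | i = s → (∃ p' ∈ W, (∀ x ∈ W, g x = x ↔ x = p') ∧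
      Dense (Diff1.stableManifold g p')) ∧
      ∀ p, Dense (Diff1.stableManifold g p) → p ∈ Metric.closedBall a (r₁ / 3)} ∩
    {g | i = t → (∃ p' ∈ W', (∀ x ∈ W', g x = x ↔ x = p') ∧
      Dense (Diff1.unstableManifold g p')) ∧
      ∀ p, g p = p → Dense (Diff1.unstableManifold g p) → p ∈ Metric.ball q (r₂ / 2)}),
    fun i => inter_mem (hU i) (inter_mem ?_ ?_),
    -- This makes both displacements small: `C / (lam - ν ^ α) < ρ` for pulling back in `B`, and `C
    -- / (bet⁻¹ - ν ^ α) < r₁ / 3` for the shadowing point of `p'` to lie in `B`.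
    min (ρ * (lam - ν ^ α)) (r₁ / 3 * (bet⁻¹ - ν ^ α)), lt_min (by positivity) (by positivity),
    fun Ψ hΨ hΨU hΨC => ?_⟩
  · by_cases hi : i = s
    · subst hi
      filter_upwards [hWev, haev] with g h1 h2 _ using ⟨h1, h2⟩
    · exact Eventually.of_forall fun g h => absurd h hi
  · by_cases hi : i = t
    · subst hi
      filter_upwards [hWev', hqev] with g h1 h2 _ using ⟨h1, h2⟩
    · exact Eventually.of_forall fun g h => absurd h hi
  obtain ⟨C, hC, hdom⟩ := hΨ.exists_isDominated hν0 hν1 hα0 hΨC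
  have hCρ : C / (lam - ν ^ α) < ρ := (div_lt_iff₀ h1).2 (hC.trans_le (min_le_left _ _))
  have hCr : C / (bet⁻¹ - ν ^ α) < r₁ / 3 := (div_lt_iff₀ h2).2 (hC.trans_le (min_le_right _ _))
  have hcover' := hcc Ψ fun ξ => (hΨU ξ).1
  obtain ⟨⟨p', hp'W, hp'u, hp'd⟩, hp'⟩ := (hΨU fun _ => s).2.1 rfl
  obtain ⟨⟨q', hq'W, hq'u, hq'd⟩, hq'⟩ := (hΨU fun _ => t).2.2 rfl
  have hp'fix := (hp'u p' hp'W).2 rfl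
  have hp'a := hp' p' hp'd
  have hq'q := hq' q' ((hq'u q' hq'W).2 rfl) hq'd
  rw [Metric.mem_closedBall] at hp'a
  rw [Metric.mem_ball] at hq'q
  have hpB : Metric.closedBall p' (r₁ / 3) ⊆ B := fun x hx => hr₁B <| by
    have h3 := dist_triangle x p' a
    rw [Metric.mem_closedBall] at hx
    rw [Metric.mem_ball]
    linarith
  have hqB' : Metric.ball q' ρ ⊆ B := fun x hx => hr₂B <| by
    have h3 := dist_triangle x q' q
    rw [Metric.mem_ball] at hx ⊢
    linarith
  have hda : Dense {x | Tendsto (fun n : ℕ => (Ψ.toSkewProduct.fiber fun _ => s)^[n] x) atTop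
      (𝓝 p')} := hp'd.mono fun x hx => tendsto_iff_dist_tendsto_zero.2 hx
  have hdq : Dense {x | Tendsto (fun n : ℕ => (Ψ.toSkewProduct.fiber fun _ => t).symm^[n] x) atTop
      (𝓝 q')} := hq'd.mono fun x hx => tendsto_iff_dist_tendsto_zero.2 hx
  refine ⟨⟨p', hp'W, fun x hx => (Ψ.map_const_eq_iff s x).trans (hp'u x hx),
    hdom.dense_stableSet hp'fix hda, hdom.dense_unstableSet hcover' hCρ hp'fix
      ((Metric.closedBall_subset_closedBall hCr.le).trans (hpB.trans hBK)) hqB' hdq⟩,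
    hdom.topMixing hcover' hCρ isClosed_closure.isCompact hs
      (mem_of_superset (Metric.closedBall_mem_nhds p' (by positivity)) (hpB.trans hBK)) hda hqB'
      hdq⟩

end Robustness

/-! ### The fixed point in the blender and the theorem -/

lemma SkewProduct.mem_maxInvariant_of_map_eq {d : ℕ} {M : Type*} [TopologicalSpace M]
    {Φ : SkewProduct d M} {D : Set M} {z : Seq d × M} (hz : Φ.map z = z) (hD : z.2 ∈ closure D) :
    z ∈ Φ.maxInvariant D :=
  mem_iInter.2 fun m => ⟨z, ⟨mem_univ _, hD⟩, (Function.IsFixedPt.perm_zpow hz m)⟩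

end SymbolicSkew

theorem theorem5p7 {n : ℕ} {M : Type*} [MetricSpace M] [CompactSpace M]
    [ChartedSpace (EuclideanSpace ℝ (Fin n)) M] [IsManifold (𝓡 n) ∞ M]
    [RiemannianBundle (fun x : M => TangentSpace (𝓡 n) x)]
    [IsContMDiffRiemannianBundle (𝓡 n) ∞ (EuclideanSpace ℝ (Fin n))
      (fun x : M => TangentSpace (𝓡 n) x)]
    [IsRiemannianManifold (𝓡 n) M]
    {ν α lam bet : ℝ} (hν0 : 0 < ν) (hν1 : ν < 1) (hα0 : 0 < α) (hα1 : α ≤ 1)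
    {k d : ℕ} (hk : 2 ≤ k) (hkd : k < d)
    (φ : Fin d → SymbolicSkew.Diff1 n M)
    (hΦ : SymbolicSkew.MemPHS ν α lam bet (SymbolicSkew.oneStep φ))
    -- the restriction to the first `k` symbols has a symbolic cs-blender, the maximal invariant
    -- set in `Σ_k × closure D`, whose superposition domain contains `B`
    (D B : Set M) {lam' bet' : ℝ}
    (hblender : SymbolicSkew.SkewProduct.IsCsBlender ν α lam' bet' D B
      (SymbolicSkew.oneStep fun i : Fin k => φ (Fin.castLE hkd.le i)).toSkewProduct)
    (hB : IsOpen B)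
    (hcover : closure B ⊆ ⋃ i : Fin k, φ (Fin.castLE hkd.le i) '' B)
    -- the attracting fixed point of `φ_1` and the repelling fixed point of `φ_{k+1}`
    (hattr : ∃ a ∈ B, (φ ⟨0, by omega⟩).IsAttracting a ∧ (φ ⟨0, by omega⟩).StableRobustlyDense a)
    (hrep : ∃ q ∈ B, (φ ⟨k, hkd⟩).IsRepelling q ∧ (φ ⟨k, hkd⟩).UnstableRobustlyDense q) :
    (∃ (ϑ : SymbolicSkew.Seq k) (p : M),
      (ϑ, p) ∈ (SymbolicSkew.oneStep fun i : Fin k =>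
        φ (Fin.castLE hkd.le i)).toSkewProduct.maxInvariant D ∧
      (SymbolicSkew.oneStep φ).toSkewProduct.map (SymbolicSkew.inclSeq hkd.le ϑ, p) =
        (SymbolicSkew.inclSeq hkd.le ϑ, p) ∧
      SymbolicSkew.StableSetRobustlyDense ν α lam bet φ (SymbolicSkew.inclSeq hkd.le ϑ) p ∧
      SymbolicSkew.UnstableSetRobustlyDense ν α lam bet φ (SymbolicSkew.inclSeq hkd.le ϑ) p) ∧
    SymbolicSkew.RobustlyAt ν α lam bet φ (fun Ψ => Ψ.toSkewProduct.TopMixing) := by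
  have : IsContinuousRiemannianBundle (EuclideanSpace ℝ (Fin n))
      (fun x : M => TangentSpace (𝓡 n) x) :=
    SymbolicSkew.isContinuousRiemannianBundle_of_contMDiff (n := ∞)
  -- The blender supplies an open `D ⊇ B` whose closure is mapped into `D` and contracted by the
  -- first `k` fibre maps. Together with `hcover` this is the contracting cover that drives the
  -- proof.
  obtain ⟨hD, hlam'0, hlam', hbet'1, hmem, B', -, -, hB'D, hBB', -⟩ := hblender
  obtain ⟨a, haB, ⟨ha, -⟩, had⟩ := hattr
  obtain ⟨q, hqB, hq, hqd⟩ := hrep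
  have hBD := hBB'.trans hB'D
  obtain ⟨hlam, -, hbet, hbet', -⟩ := hΦ
  have hcover' : closure B ⊆ ⋃ i ∈ {i : Fin d | (i : ℕ) < k}, φ i '' B := by
    refine hcover.trans (iUnion_subset fun i => ?_)
    exact subset_biUnion_of_mem (u := fun i : Fin d => φ i '' B)
      (show Fin.castLE hkd.le i ∈ {i : Fin d | (i : ℕ) < k} from i.2)
  obtain ⟨W, hW, h⟩ := SymbolicSkew.exists_robustlyAt_dense_mixing (lam := lam) (bet := bet)
    hν0 hν1 hα0 hlam hbet hbet' (S := {i : Fin d | (i : ℕ) < k}) (φ := φ) hD hB hBD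
    (hlam'0.trans hlam').le hbet'1
    (fun i hi x hx y hy => by
      rcases eq_or_ne x y with rfl | hxy
      · simp
      · exact (hmem.biLip (fun _ => ⟨i, hi⟩) x hx y hy hxy).2.le)
    (fun i hi => hmem.contracting hbet'1 fun _ => ⟨i, hi⟩) hcover'
    (s := ⟨0, by omega⟩) (t := ⟨k, hkd⟩) (show 0 < k by omega) haB ha had hqB hq hqd
  have hfix : φ ⟨0, by omega⟩ a = a := ha
  -- The fixed point is the attracting one over the constant sequence of the first symbol; being
  -- fixed over `D`, it belongs to the maximal invariant set.
  refine ⟨⟨fun _ => ⟨0, by omega⟩, a, SymbolicSkew.SkewProduct.mem_maxInvariant_of_map_eq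
    (Prod.ext rfl hfix) (subset_closure (hBD haB)), Prod.ext rfl hfix,
    ⟨W, hW, h.mono fun Ψ hΨ => ?_⟩, ⟨W, hW, h.mono fun Ψ hΨ => ?_⟩⟩, h.mono fun Ψ hΨ => hΨ.2⟩
  · obtain ⟨⟨p', hp', hu, hs, -⟩, -⟩ := hΨ
    exact ⟨p', hp', hu, hs⟩
  · obtain ⟨⟨p', hp', hu, -, hs⟩, -⟩ := hΨ
    exact ⟨p', hp', hu, hs⟩
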